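/- Let $n\ge 0$ and let $C,D\subseteq\mathbb{F}_2^n$ be doubly-even binary linear codes of length $n$, i.e. linear subspaces in which the number of nonzero coordinates of every codeword is divisible by $4$. Let $\alpha_1,\dots,\alpha_n$ be an orthogonal basis of the Euclidean space $\mathbb{R}^n$ with $(\alpha_i,\alpha_i)=2$ for all $i$ (concretely $\alpha_i=\sqrt2\,e_i$, where $e_1,\dots,e_n$ is the standard basis), and for $c=(c_1,\dots,c_n)\in\mathbb{F}_2^n$ put $\alpha_c=\sum_{i=1}^n c_i\alpha_i$, where each $c_i$ is read as an integer in $\{0,1\}$. For a binary code $C$ of length $n$ define the lattice $$\mathcal{L}^+(C)=\sum_{1\le i,j\le n}\mathbb{Z}(\alpha_i+\alpha_j)+\sum_{c\in C}\mathbb{Z}\,\tfrac12\alpha_c\ \subset\ \mathbb{R}^n .$$ Call two lattices in $\mathbb{R}^n$ isomorphic if some orthogonal transformation of $\mathbb{R}^n$ maps one onto the other, call two codes equivalent if one is obtained from the other by a permutation of the coordinates, and call a code $C$ self-dual if $C=C^\perp=\{x\in\mathbb{F}_2^n\mid \sum_i x_iy_i=0\text{ for all }y\in C\}$. Then $\mathcal{L}^+(C)\cong\mathcal{L}^+(D)$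 if and only if one of the following holds: 1. $C$ and $D$ are equivalent; 2. $n=16$ and $C$ and $D$ are both self-dual (hence doubly-even self-dual codes of length $16$). -/

import Mathlib

namespace CodeLattice

/-- A binary linear code of length `n`: a subspace of `𝔽₂ⁿ`. -/
abbrev BinaryCode (n : ℕ) : Type := Submodule (ZMod 2) (Fin n → ZMod 2)

/-- A code is doubly-even if the weight of each codeword (its number of nonzero
coordinates) is divisible by `4`. -/
def IsDoublyEven {n : ℕ} (C : BinaryCode n) : Prop :=
  ∀ x ∈ C, 4 ∣ hammingNorm x

/-- The dual code: all `x` with `∑ i, x i * y i = 0` for all `y ∈ C`. -/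
def dualCode {n : ℕ} (C : BinaryCode n) : BinaryCode n where
  carrier := {x | ∀ y ∈ C, x ⬝ᵥ y = 0}
  zero_mem' := fun y _ => zero_dotProduct y
  add_mem' := fun {a b} ha hb y hy => by rw [add_dotProduct, ha y hy, hb y hy, add_zero]
  smul_mem' := fun r x hx y hy => by rw [smul_dotProduct, hx y hy, smul_zero]

/-- A code is self-dual if it is equal to its dual code. -/
def IsSelfDual {n : ℕ} (C : BinaryCode n) : Prop :=
  dualCode C = C

/-- Two codes are equivalent if one is obtained from the other by a permutation of
the coordinates. -/
def CodeEquiv {n : ℕ} (C D : BinaryCode n) : Prop :=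
  ∃ σ : Equiv.Perm (Fin n), (fun x : Fin n → ZMod 2 => x ∘ σ) '' (C : Set (Fin n → ZMod 2)) = D

/-- The orthogonal basis `α₁, …, αₙ` of `ℝⁿ` with `(αᵢ, αᵢ) = 2`, that is `αᵢ = √2 eᵢ`. -/
noncomputable def alpha {n : ℕ} (i : Fin n) : EuclideanSpace ℝ (Fin n) :=
  Real.sqrt 2 • EuclideanSpace.single i (1 : ℝ)

/-- `α_c = ∑ i, c i • α i`, the coordinates of `c` being read as the integers `0` and `1`. -/
noncomputable def alphaWord {n : ℕ} (c : Fin n → ZMod 2) : EuclideanSpace ℝ (Fin n) :=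
  ∑ i, (c i).val • alpha i

/-- Construction B: `𝓛⁺(C) = ∑ i j, ℤ (α i + α j) + ∑ c ∈ C, ℤ (1/2) α_c`
(the case `i = j` included). -/
noncomputable def latticePlus {n : ℕ} (C : BinaryCode n) :
    Submodule ℤ (EuclideanSpace ℝ (Fin n)) :=
  Submodule.span ℤ {v | ∃ i j : Fin n, v = alpha i + alpha j} ⊔
    Submodule.span ℤ {v | ∃ c ∈ C, v = (1 / 2 : ℝ) • alphaWord c}

/-- Two lattices in `ℝⁿ` are isomorphic if an orthogonal transformation of `ℝⁿ` maps one
onto the other. -/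
def LatticeIso {n : ℕ} (L M : Submodule ℤ (EuclideanSpace ℝ (Fin n))) : Prop :=
  ∃ g : EuclideanSpace ℝ (Fin n) ≃ₗᵢ[ℝ] EuclideanSpace ℝ (Fin n),
    g '' (L : Set (EuclideanSpace ℝ (Fin n))) = M

end CodeLattice

namespace CodeLattice

variable {n : ℕ}

/-! ### Binary words and doubly-even codes -/

/-- The reduction modulo `2` of an integer vector. -/
def redMod (m : Fin n → ℤ) : Fin n → ZMod 2 := fun i => (m i : ZMod 2)

/-- The lift of a binary word with entries `0` and `1`. -/
def liftWord (c : Fin n → ZMod 2) : Fin n → ℤ := fun i => ((c i).val : ℤ)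

@[simp] theorem redMod_liftWord (c : Fin n → ZMod 2) : redMod (liftWord c) = c := by
  ext i; simp [redMod, liftWord]

theorem redMod_add (m k : Fin n → ℤ) : redMod (m + k) = redMod m + redMod k := by
  ext i; simp [redMod]

theorem redMod_sub (m k : Fin n → ℤ) : redMod (m - k) = redMod m - redMod k := by
  ext i; simp [redMod]

theorem redMod_zsmul (a : ℤ) (m : Fin n → ℤ) : redMod (a • m) = (a : ZMod 2) • redMod m := by
  ext i; simp [redMod]

theorem redMod_dotProduct (m k : Fin n → ℤ) :
    redMod m ⬝ᵥ redMod k = ((m ⬝ᵥ k : ℤ) : ZMod 2) := by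
  simp [redMod, dotProduct]

theorem zmod_two_val_eq_ite (a : ZMod 2) : a.val = if a ≠ 0 then 1 else 0 := by
  revert a; decide

theorem word_sub_eq_add (x y : Fin n → ZMod 2) : x - y = x + y := by
  ext i; simp only [Pi.sub_apply, Pi.add_apply]; generalize x i = a; generalize y i = b
  revert a b; decide

theorem word_add_self (x : Fin n → ZMod 2) : x + x = 0 := by
  rw [← word_sub_eq_add, sub_self]

theorem sum_liftWord (c : Fin n → ZMod 2) : ∑ i, liftWord c i = (hammingNorm c : ℤ) := by
  simp only [liftWord, hammingNorm, zmod_two_val_eq_ite, Finset.card_filter]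
  push_cast; rfl

theorem hammingNorm_add_eq (x y : Fin n → ZMod 2) :
    (hammingNorm (x + y) : ℤ) =
      hammingNorm x + hammingNorm y - 2 * (liftWord x ⬝ᵥ liftWord y) := by
  rw [← sum_liftWord, ← sum_liftWord, ← sum_liftWord, dotProduct, Finset.mul_sum,
    ← Finset.sum_add_distrib, ← Finset.sum_sub_distrib]
  refine Finset.sum_congr rfl fun i _ => ?_
  simp only [liftWord, Pi.add_apply]
  generalize x i = a; generalize y i = b; revert a b; decide

theorem dotProduct_eq_liftWord (x y : Fin n → ZMod 2) :
    x ⬝ᵥ y = ((liftWord x ⬝ᵥ liftWord y : ℤ) : ZMod 2) := by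
  rw [← redMod_dotProduct, redMod_liftWord, redMod_liftWord]

theorem dotProduct_eq_zero_iff_even (x y : Fin n → ZMod 2) :
    x ⬝ᵥ y = 0 ↔ (2 : ℤ) ∣ liftWord x ⬝ᵥ liftWord y := by
  rw [dotProduct_eq_liftWord]; exact ZMod.intCast_zmod_eq_zero_iff_dvd _ 2 |>.trans (by norm_num)

theorem word_dotProduct_self (x : Fin n → ZMod 2) : x ⬝ᵥ x = (hammingNorm x : ZMod 2) := by
  have h := congrArg (Int.cast : ℤ → ZMod 2) (sum_liftWord x)
  push_cast at h
  rw [← h, dotProduct]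
  refine Finset.sum_congr rfl fun i _ => ?_
  simp only [liftWord]
  generalize x i = a; revert a; decide

theorem four_dvd_hammingNorm_add_iff {x y : Fin n → ZMod 2} (hx : 4 ∣ hammingNorm x)
    (hy : 4 ∣ hammingNorm y) : 4 ∣ hammingNorm (x + y) ↔ x ⬝ᵥ y = 0 := by
  rw [dotProduct_eq_zero_iff_even]
  have := hammingNorm_add_eq x y
  omega

theorem IsDoublyEven.dotProduct_eq_zero {C : BinaryCode n} (hC : IsDoublyEven C)
    {x y : Fin n → ZMod 2} (hx : x ∈ C) (hy : y ∈ C) : x ⬝ᵥ y = 0 :=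
  (four_dvd_hammingNorm_add_iff (hC x hx) (hC y hy)).1 (hC _ (C.add_mem hx hy))

theorem IsDoublyEven.le_dualCode {C : BinaryCode n} (hC : IsDoublyEven C) : C ≤ dualCode C :=
  fun _ hx _ hy => hC.dotProduct_eq_zero hx hy

theorem exists_mem_dualCode_dotProduct_eq_one {C : BinaryCode n} {d : Fin n → ZMod 2}
    (hd : d ∉ C) : ∃ z ∈ dualCode C, z ⬝ᵥ d = 1 := by
  obtain ⟨f, hfd, hf⟩ := Submodule.exists_le_ker_of_notMem hd
  have key : ∀ x, (fun i => f (Pi.single i 1)) ⬝ᵥ x = f x := by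
    intro x
    conv_rhs => rw [← Finset.univ_sum_single x, map_sum]
    refine Finset.sum_congr rfl fun i _ => ?_
    have : (Pi.single i (x i) : Fin n → ZMod 2) = x i • Pi.single i 1 := by
      rw [← Pi.single_smul, smul_eq_mul, mul_one]
    rw [this, map_smul, smul_eq_mul, mul_comm]
  refine ⟨fun i => f (Pi.single i 1), fun y hy => ?_, ?_⟩
  · rw [key]; exact hf hy
  · rw [key]; revert hfd; generalize f d = a; revert a; decide

theorem dualCode_dualCode (C : BinaryCode n) : dualCode (dualCode C) = C := by
  refine le_antisymm (fun x hx => ?_) fun x hx y hy => ?_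
  · by_contra h
    obtain ⟨z, hz, h1⟩ := exists_mem_dualCode_dotProduct_eq_one h
    have := hx z hz
    rw [dotProduct_comm, h1] at this
    exact one_ne_zero this
  · rw [dotProduct_comm]; exact hy x hx

/-! ### The scaled lattice and its cosets -/

/-- An integer vector regarded as a real vector. -/
def intVec (m : Fin n → ℤ) : Fin n → ℝ := fun i => (m i : ℝ)

@[simp] theorem intVec_apply (m : Fin n → ℤ) (i : Fin n) : intVec m i = m i := rfl

theorem intVec_add (m k : Fin n → ℤ) : intVec (m + k) = intVec m + intVec k := by
  ext i; simp

theorem intVec_sub (m k : Fin n → ℤ) : intVec (m - k) = intVec m - intVec k := by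
  ext i; simp

theorem intVec_zsmul (a : ℤ) (m : Fin n → ℤ) : intVec (a • m) = (a : ℝ) • intVec m := by
  ext i; simp

theorem intVec_dotProduct (m k : Fin n → ℤ) :
    intVec m ⬝ᵥ intVec k = ((m ⬝ᵥ k : ℤ) : ℝ) := by
  simp [intVec, dotProduct]

theorem intVec_injective : Function.Injective (intVec : (Fin n → ℤ) → _) := fun m k h => by
  ext i
  have := congrFun h i
  simp only [intVec_apply] at this
  exact_mod_cast this

/-- The integer vectors reducing modulo `2` to a codeword and having coordinate sum congruent
to `r` modulo `4`. For `r = 0` and `C` doubly-even this is the lattice `√2 𝓛⁺(C)`. -/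
def shell (C : BinaryCode n) (r : ℤ) : Set (Fin n → ℝ) :=
  {x | ∃ m : Fin n → ℤ, x = intVec m ∧ redMod m ∈ C ∧ (4 : ℤ) ∣ ∑ i, m i - r}

theorem intVec_mem_shell {C : BinaryCode n} {r : ℤ} {m : Fin n → ℤ} :
    intVec m ∈ shell C r ↔ redMod m ∈ C ∧ (4 : ℤ) ∣ ∑ i, m i - r := by
  constructor
  · rintro ⟨k, hk, h⟩
    rwa [intVec_injective hk]
  · exact fun h => ⟨m, rfl, h⟩

theorem shell_congr {C : BinaryCode n} {r s : ℤ} {x : Fin n → ℝ} (hx : x ∈ shell C r)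
    (h : (4 : ℤ) ∣ r - s) : x ∈ shell C s := by
  obtain ⟨m, rfl, h1, h2⟩ := hx
  exact ⟨m, rfl, h1, by omega⟩

theorem add_mem_shell {C : BinaryCode n} {r s : ℤ} {x y : Fin n → ℝ} (hx : x ∈ shell C r)
    (hy : y ∈ shell C s) : x + y ∈ shell C (r + s) := by
  obtain ⟨m, rfl, h1, h2⟩ := hx
  obtain ⟨k, rfl, h3, h4⟩ := hy
  refine ⟨m + k, (intVec_add m k).symm, ?_, ?_⟩
  · rw [redMod_add]; exact C.add_mem h1 h3
  · simp only [Pi.add_apply, Finset.sum_add_distrib]; omega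

theorem sub_mem_shell {C : BinaryCode n} {r s : ℤ} {x y : Fin n → ℝ} (hx : x ∈ shell C r)
    (hy : y ∈ shell C s) : x - y ∈ shell C (r - s) := by
  obtain ⟨m, rfl, h1, h2⟩ := hx
  obtain ⟨k, rfl, h3, h4⟩ := hy
  refine ⟨m - k, (intVec_sub m k).symm, ?_, ?_⟩
  · rw [redMod_sub]; exact C.sub_mem h1 h3
  · simp only [Pi.sub_apply, Finset.sum_sub_distrib]; omega

theorem zsmul_mem_shell {C : BinaryCode n} {r : ℤ} (a : ℤ) {x : Fin n → ℝ}
    (hx : x ∈ shell C r) : (a : ℝ) • x ∈ shell C (a * r) := by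
  obtain ⟨m, rfl, h1, h2⟩ := hx
  refine ⟨a • m, (intVec_zsmul a m).symm, ?_, ?_⟩
  · rw [redMod_zsmul]; exact C.smul_mem _ h1
  · simp only [Pi.smul_apply, smul_eq_mul, ← Finset.mul_sum, ← mul_sub]
    exact Dvd.dvd.mul_left h2 a

theorem zero_mem_shell (C : BinaryCode n) : (0 : Fin n → ℝ) ∈ shell C 0 :=
  ⟨0, by ext; simp, by convert C.zero_mem; ext; simp [redMod], by simp⟩

theorem intVec_liftWord_mem_shell {C : BinaryCode n} (hC : IsDoublyEven C) {c : Fin n → ZMod 2}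
    (hc : c ∈ C) : intVec (liftWord c) ∈ shell C 0 := by
  rw [intVec_mem_shell, redMod_liftWord, sum_liftWord]
  have := hC c hc
  exact ⟨hc, by omega⟩

theorem single_two_mem_shell (C : BinaryCode n) (i : Fin n) :
    (Pi.single i 2 : Fin n → ℝ) ∈ shell C 2 := by
  refine ⟨Pi.single i 2, ?_, ?_, ?_⟩
  · ext j; by_cases h : j = i
    · subst h; simp
    · simp [h]
  · convert C.zero_mem
    ext j; by_cases h : j = i
    · subst h; simp only [redMod, Pi.single_eq_same, Pi.zero_apply]; rfl
    · simp [redMod, h]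
  · simp

theorem not_mem_shell_of_mem {C : BinaryCode n} {r s : ℤ} {x : Fin n → ℝ} (hx : x ∈ shell C r)
    (h : ¬ (4 : ℤ) ∣ r - s) : x ∉ shell C s := by
  obtain ⟨m, rfl, h1, h2⟩ := hx
  rw [intVec_mem_shell]
  rintro ⟨-, h3⟩
  omega

theorem exists_dotProduct_eq_two_mul {m k : Fin n → ℤ} (h : redMod m ⬝ᵥ redMod k = 0) :
    ∃ a : ℤ, m ⬝ᵥ k = 2 * a := by
  rw [redMod_dotProduct] at h
  exact (ZMod.intCast_zmod_eq_zero_iff_dvd _ 2).1 h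

/-! ### Isometries between the scaled lattices -/

/-- `g` is an orthogonal transformation of `ℝⁿ` taking `√2 𝓛⁺(C)` onto `√2 𝓛⁺(D)`. -/
structure IsLatIso (C D : BinaryCode n) (g : (Fin n → ℝ) ≃ₗ[ℝ] (Fin n → ℝ)) : Prop where
  dot : ∀ x y, g x ⬝ᵥ g y = x ⬝ᵥ y
  mem : ∀ x, g x ∈ shell D 0 ↔ x ∈ shell C 0

theorem IsLatIso.symm {C D : BinaryCode n} {g} (h : IsLatIso C D g) : IsLatIso D C g.symm where
  dot x y := by rw [← h.dot, g.apply_symm_apply, g.apply_symm_apply]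
  mem x := by rw [← h.mem, g.apply_symm_apply]

theorem IsLatIso.trans {C D F : BinaryCode n} {g k} (h : IsLatIso C D g) (h' : IsLatIso D F k) :
    IsLatIso C F (g.trans k) where
  dot x y := by rw [LinearEquiv.trans_apply, LinearEquiv.trans_apply, h'.dot, h.dot]
  mem x := by rw [LinearEquiv.trans_apply, h'.mem, h.mem]

/-- An isometry matching one pair of vectors of the frame classes matches all of them. -/
theorem IsLatIso.map_shell_two {C D : BinaryCode n} {g} (h : IsLatIso C D g) {x : Fin n → ℝ}
    (hx : x ∈ shell C 2) (hgx : g x ∈ shell D 2) {y : Fin n → ℝ} (hy : y ∈ shell C 2) :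
    g y ∈ shell D 2 := by
  have h1 : g (y - x) ∈ shell D 0 := (h.mem _).2 (by simpa using sub_mem_shell hy hx)
  have := add_mem_shell h1 hgx
  rwa [map_sub, sub_add_cancel, zero_add] at this

theorem sqrt_two_mul_alpha (i j : Fin n) :
    √2 * (alpha i : EuclideanSpace ℝ (Fin n)) j = (Pi.single i 2 : Fin n → ℝ) j := by
  have h : √2 * √2 = (2 : ℝ) := Real.mul_self_sqrt (by norm_num)
  by_cases hij : j = i
  · subst hij; simp [alpha, h]
  · simp [alpha, hij]

theorem sqrt_two_mul_half_alphaWord (c : Fin n → ZMod 2) (j : Fin n) :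
    √2 * ((1 / 2 : ℝ) • alphaWord c : EuclideanSpace ℝ (Fin n)) j = liftWord c j := by
  have h1 : (alphaWord c : EuclideanSpace ℝ (Fin n)) j =
      ∑ i, ((c i).val : ℝ) * (alpha i : EuclideanSpace ℝ (Fin n)) j := by
    simp [alphaWord, -ZMod.natCast_val]
  rw [PiLp.smul_apply, smul_eq_mul, h1, mul_left_comm, Finset.mul_sum]
  have : ∀ i, √2 * (((c i).val : ℝ) * (alpha i : EuclideanSpace ℝ (Fin n)) j) =
      ((c i).val : ℝ) * (Pi.single i 2 : Fin n → ℝ) j := fun i => by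
    rw [mul_left_comm, sqrt_two_mul_alpha]
  simp only [this, Pi.single_apply, mul_ite, mul_zero, Finset.sum_ite_eq, Finset.mem_univ, if_true]
  simp [liftWord, -ZMod.natCast_val]
  ring

/-- The lattice `𝓛⁺(C)` in coordinates. -/
theorem mem_latticePlus_iff {C : BinaryCode n} (hC : IsDoublyEven C)
    (x : EuclideanSpace ℝ (Fin n)) :
    x ∈ latticePlus C ↔ (fun i => √2 * x i) ∈ shell C 0 := by
  have h2 : (√2 : ℝ) ≠ 0 := by positivity
  constructor
  · intro hx
    let S : Submodule ℤ (EuclideanSpace ℝ (Fin n)) :=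
      { carrier := {x | (fun i => √2 * x i) ∈ shell C 0}
        zero_mem' := by
          change (fun i => √2 * (0 : EuclideanSpace ℝ (Fin n)) i) ∈ shell C 0
          convert zero_mem_shell C using 1
          ext; simp
        add_mem' := fun {a b} ha hb => by
          have := add_mem_shell ha hb
          rw [add_zero] at this
          change (fun i => √2 * (a + b) i) ∈ shell C 0
          convert this using 1
          ext; simp [mul_add]
        smul_mem' := fun k a ha => by
          have := zsmul_mem_shell k ha
          rw [mul_zero] at this
          change (fun i => √2 * (k • a) i) ∈ shell C 0
          convert this using 1
          ext; simp; ring }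
    have : latticePlus C ≤ S := by
      refine sup_le (Submodule.span_le.2 ?_) (Submodule.span_le.2 ?_)
      · rintro _ ⟨i, j, rfl⟩
        have := add_mem_shell (single_two_mem_shell C i) (single_two_mem_shell C j)
        replace this := shell_congr (s := 0) this (by norm_num)
        change (fun k => √2 * (alpha i + alpha j : EuclideanSpace ℝ (Fin n)) k) ∈ shell C 0
        convert this using 1
        ext k
        rw [PiLp.add_apply, mul_add, sqrt_two_mul_alpha, sqrt_two_mul_alpha, Pi.add_apply]
      · rintro _ ⟨c, hc, rfl⟩
        change (fun k => √2 * ((1 / 2 : ℝ) • alphaWord c : EuclideanSpace ℝ (Fin n)) k) ∈ shell C 0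
        convert intVec_liftWord_mem_shell hC hc using 1
        ext k
        rw [sqrt_two_mul_half_alphaWord, intVec_apply]
    exact this hx
  · rintro ⟨m, hm, hc, hs⟩
    set c := redMod m with hcdef
    have hk : ∀ i, ∃ k : ℤ, m i = liftWord c i + 2 * k := by
      intro i
      have : ((m i - liftWord c i : ℤ) : ZMod 2) = 0 := by
        have h := congrFun (redMod_liftWord c) i
        simp only [redMod, hcdef] at h ⊢
        push_cast
        rw [h, sub_self]
      obtain ⟨k, hk⟩ := (ZMod.intCast_zmod_eq_zero_iff_dvd _ 2).1 this
      exact ⟨k, by push_cast at hk; linarith⟩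
    choose k hk using hk
    have hx : x = (1 / 2 : ℝ) • alphaWord c + ∑ i, k i • alpha i := by
      ext j
      apply mul_left_cancel₀ h2
      have h1 : √2 * (∑ i, k i • alpha i : EuclideanSpace ℝ (Fin n)) j = 2 * k j := by
        have : (∑ i, k i • alpha i : EuclideanSpace ℝ (Fin n)) j
            = ∑ i, (k i : ℝ) * (alpha i : EuclideanSpace ℝ (Fin n)) j := by simp
        rw [this, Finset.mul_sum]
        simp only [mul_left_comm √2, sqrt_two_mul_alpha, Pi.single_apply, mul_ite, mul_zero,
          Finset.sum_ite_eq, Finset.mem_univ, if_true]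
        ring
      rw [PiLp.add_apply, mul_add, sqrt_two_mul_half_alphaWord, h1]
      have := congrFun hm j
      simp only [intVec_apply] at this
      rw [this, hk j]
      push_cast; ring
    have hsum : (2 : ℤ) ∣ ∑ i, k i := by
      have h3 : ∑ i, m i = hammingNorm c + 2 * ∑ i, k i := by
        rw [← sum_liftWord, Finset.mul_sum, ← Finset.sum_add_distrib]
        exact Finset.sum_congr rfl fun i _ => hk i
      have := hC c hc
      omega
    rw [hx]
    refine Submodule.add_mem _ (Submodule.mem_sup_right (Submodule.subset_span ⟨c, hc, rfl⟩))
      (Submodule.mem_sup_left ?_)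
    rcases isEmpty_or_nonempty (Fin n) with hn | ⟨⟨i₀⟩⟩
    · simp
    obtain ⟨a, ha⟩ := hsum
    have h4 : ∑ i, k i • (alpha i : EuclideanSpace ℝ (Fin n)) =
        ∑ i, k i • ((alpha i + alpha i₀) - (alpha i₀ + alpha i₀)) +
          a • (alpha i₀ + alpha i₀) := by
      have : ∀ i, k i • ((alpha i + alpha i₀) - (alpha i₀ + alpha i₀) :
          EuclideanSpace ℝ (Fin n)) = k i • alpha i - k i • alpha i₀ := fun i => by
        rw [add_sub_add_right_eq_sub, smul_sub]
      simp only [this]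
      rw [Finset.sum_sub_distrib, ← Finset.sum_smul, ha, ← two_smul ℤ (alpha i₀), smul_smul,
        mul_comm a 2, sub_add_cancel]
    rw [h4]
    have hmem : ∀ i j : Fin n, (alpha i + alpha j : EuclideanSpace ℝ (Fin n)) ∈
        Submodule.span ℤ {v | ∃ i j : Fin n, v = alpha i + alpha j} :=
      fun i j => Submodule.subset_span ⟨i, j, rfl⟩
    exact Submodule.add_mem _ (Submodule.sum_mem _ fun i _ =>
      Submodule.smul_mem _ _ (Submodule.sub_mem _ (hmem _ _) (hmem _ _)))
      (Submodule.smul_mem _ _ (hmem _ _))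

/-- Isomorphy of the lattices in terms of the scaled ones. -/
theorem latticeIso_iff {C D : BinaryCode n} (hC : IsDoublyEven C) (hD : IsDoublyEven D) :
    LatticeIso (latticePlus C) (latticePlus D) ↔ ∃ g, IsLatIso C D g := by
  have h2 : (√2 : ℝ) ≠ 0 := by positivity
  let w : EuclideanSpace ℝ (Fin n) ≃ₗ[ℝ] (Fin n → ℝ) := WithLp.linearEquiv 2 ℝ (Fin n → ℝ)
  have hw : ∀ x i, w x i = x i := fun _ _ => rfl
  have hinner : ∀ x y : EuclideanSpace ℝ (Fin n), inner ℝ x y = w y ⬝ᵥ w x := fun x y => by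
    simp [PiLp.inner_apply, dotProduct, hw]
  have hmemC : ∀ x, x ∈ latticePlus C ↔ √2 • w x ∈ shell C 0 := fun x =>
    mem_latticePlus_iff hC x
  have hmemD : ∀ x, x ∈ latticePlus D ↔ √2 • w x ∈ shell D 0 := fun x =>
    mem_latticePlus_iff hD x
  constructor
  · rintro ⟨g, hg⟩
    refine ⟨(w.symm.trans g.toLinearEquiv).trans w, fun x y => ?_, fun x => ?_⟩
    · obtain ⟨x, rfl⟩ := w.surjective x
      obtain ⟨y, rfl⟩ := w.surjective y
      simp only [LinearEquiv.trans_apply, LinearEquiv.symm_apply_apply]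
      rw [← hinner, ← hinner]
      exact g.inner_map_map _ _
    · obtain ⟨x, rfl⟩ := (w.trans (LinearEquiv.smulOfNeZero ℝ _ √2 h2)).surjective x
      have : (w.trans (LinearEquiv.smulOfNeZero ℝ _ √2 h2)) x = √2 • w x := rfl
      rw [this, map_smul, ← hmemC]
      simp only [LinearEquiv.trans_apply, LinearEquiv.symm_apply_apply]
      rw [← hmemD, ← SetLike.mem_coe, ← hg]
      exact g.injective.mem_set_image
  · rintro ⟨g, hg⟩
    let g' : EuclideanSpace ℝ (Fin n) ≃ₗ[ℝ] EuclideanSpace ℝ (Fin n) :=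
      (w.trans g).trans w.symm
    have hg' : ∀ x, w (g' x) = g (w x) := fun x => by simp [g']
    refine ⟨g'.isometryOfInner fun x y => ?_, ?_⟩
    · rw [hinner, hinner, hg', hg', hg.dot]
    · ext y
      have hy : ∀ x, g' x ∈ latticePlus D ↔ x ∈ latticePlus C := fun x => by
        rw [hmemD, hmemC, hg', ← map_smul, hg.mem]
      obtain ⟨x, rfl⟩ := g'.surjective y
      have h5 : g' x = (g'.isometryOfInner fun x y => by rw [hinner, hinner, hg', hg', hg.dot]) x :=
        rfl
      rw [SetLike.mem_coe, hy, h5, (LinearIsometryEquiv.injective _).mem_set_image, SetLike.mem_coe]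

/-- Equivalent codes give isometric lattices. -/
theorem CodeEquiv.exists_isLatIso {C D : BinaryCode n} (h : CodeEquiv C D) :
    ∃ g, IsLatIso C D g := by
  obtain ⟨σ, hσ⟩ := h
  refine ⟨LinearEquiv.funCongrLeft ℝ ℝ σ, fun x y => ?_, fun x => ?_⟩
  · simp only [dotProduct, LinearEquiv.funCongrLeft_apply, LinearMap.funLeft_apply]
    exact Equiv.sum_comp σ fun i => x i * y i
  · have hD : ∀ c : Fin n → ZMod 2, c ∘ σ ∈ D ↔ c ∈ C := fun c => by
      rw [← SetLike.mem_coe, ← hσ]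
      exact (Function.Injective.mem_set_image
        (f := fun x : Fin n → ZMod 2 => x ∘ σ) σ.surjective.injective_comp_right)
    have hx : LinearEquiv.funCongrLeft ℝ ℝ σ x = x ∘ σ := rfl
    rw [hx]
    constructor
    · rintro ⟨m, hm, h1, h2⟩
      refine ⟨m ∘ σ.symm, ?_, ?_, ?_⟩
      · ext i; have := congrFun hm (σ.symm i); simpa using this
      · rw [← hD]; convert h1 using 1; ext i; simp [redMod]
      · rwa [show ∑ i, (m ∘ σ.symm) i = ∑ i, m i from Equiv.sum_comp σ.symm m]
    · rintro ⟨m, rfl, h1, h2⟩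
      refine ⟨m ∘ σ, rfl, (hD (redMod m)).2 h1, ?_⟩
      rwa [show ∑ i, (m ∘ σ) i = ∑ i, m i from Equiv.sum_comp σ m]

/-! ### Products of orthogonal reflections -/

theorem multiRefl_aux {κ : Type*} {s : Finset κ} {v : κ → Fin n → ℝ} [DecidableEq κ]
    (h : ∀ k ∈ s, ∀ l ∈ s, v k ⬝ᵥ v l = if k = l then 4 else 0) (x : Fin n → ℝ) {l : κ}
    (hl : l ∈ s) : (x - ∑ k ∈ s, (x ⬝ᵥ v k / 2) • v k) ⬝ᵥ v l = - (x ⬝ᵥ v l) := by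
  rw [sub_dotProduct, sum_dotProduct]
  have : ∑ k ∈ s, ((x ⬝ᵥ v k / 2) • v k) ⬝ᵥ v l = ∑ k ∈ s, if k = l then 2 * (x ⬝ᵥ v k) else 0 := by
    refine Finset.sum_congr rfl fun k hk => ?_
    rw [smul_dotProduct, h k hk l hl, smul_eq_mul]
    split_ifs <;> ring
  rw [this, Finset.sum_ite_eq' s l, if_pos hl]
  ring

/-- The product of the reflections in the mutually orthogonal vectors `v k` of norm `4`. -/
noncomputable def multiRefl {κ : Type*} [DecidableEq κ] (s : Finset κ) (v : κ → Fin n → ℝ)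
    (h : ∀ k ∈ s, ∀ l ∈ s, v k ⬝ᵥ v l = if k = l then 4 else 0) :
    (Fin n → ℝ) ≃ₗ[ℝ] (Fin n → ℝ) :=
  LinearEquiv.ofInvolutive
    { toFun := fun x => x - ∑ k ∈ s, (x ⬝ᵥ v k / 2) • v k
      map_add' := fun x y => by
        simp only [add_dotProduct, add_div, add_smul, Finset.sum_add_distrib]; abel
      map_smul' := fun a x => by
        simp only [smul_dotProduct, smul_eq_mul, mul_div_assoc, mul_smul, ← Finset.smul_sum,
          smul_sub, RingHom.id_apply] }
    (fun x => by
      change (x - ∑ k ∈ s, (x ⬝ᵥ v k / 2) • v k) -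
        ∑ l ∈ s, ((x - ∑ k ∈ s, (x ⬝ᵥ v k / 2) • v k) ⬝ᵥ v l / 2) • v l = x
      have : ∀ l ∈ s, ((x - ∑ k ∈ s, (x ⬝ᵥ v k / 2) • v k) ⬝ᵥ v l / 2) • v l =
          -((x ⬝ᵥ v l / 2) • v l) := fun l hl => by
        rw [multiRefl_aux h x hl, neg_div, neg_smul]
      rw [Finset.sum_congr rfl this, Finset.sum_neg_distrib, sub_neg_eq_add, sub_add_cancel])

section multiRefl

variable {κ : Type*} [DecidableEq κ] {s : Finset κ} {v : κ → Fin n → ℝ}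
  {h : ∀ k ∈ s, ∀ l ∈ s, v k ⬝ᵥ v l = if k = l then 4 else 0}

theorem multiRefl_apply (x : Fin n → ℝ) :
    multiRefl s v h x = x - ∑ k ∈ s, (x ⬝ᵥ v k / 2) • v k := rfl

theorem multiRefl_multiRefl (x : Fin n → ℝ) : multiRefl s v h (multiRefl s v h x) = x :=
  (multiRefl s v h).symm_apply_apply x

theorem multiRefl_dot (x y : Fin n → ℝ) :
    multiRefl s v h x ⬝ᵥ multiRefl s v h y = x ⬝ᵥ y := by
  have h1 : multiRefl s v h x ⬝ᵥ multiRefl s v h y =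
      multiRefl s v h x ⬝ᵥ y + ∑ k ∈ s, (y ⬝ᵥ v k / 2) * (x ⬝ᵥ v k) := by
    conv_lhs => rw [multiRefl_apply y, dotProduct_sub, dotProduct_sum]
    rw [sub_eq_add_neg, ← Finset.sum_neg_distrib]
    congr 1
    refine Finset.sum_congr rfl fun k hk => ?_
    rw [dotProduct_smul, multiRefl_apply, multiRefl_aux h x hk, smul_eq_mul]
    ring
  rw [h1, multiRefl_apply, sub_dotProduct, sum_dotProduct, sub_add, sub_eq_self,
    ← Finset.sum_sub_distrib]
  refine Finset.sum_eq_zero fun k _ => ?_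
  rw [smul_dotProduct, smul_eq_mul, dotProduct_comm (v k)]
  ring

theorem isLatIso_multiRefl {C : BinaryCode n}
    (hmem : ∀ x ∈ shell C 0, multiRefl s v h x ∈ shell C 0) :
    IsLatIso C C (multiRefl s v h) where
  dot := multiRefl_dot
  mem x := ⟨fun hx => by simpa only [multiRefl_multiRefl] using hmem _ hx, hmem x⟩

end multiRefl

/-! ### Sign changes -/

theorem signFlip_aux (s : Finset (Fin n)) : ∀ k ∈ s, ∀ l ∈ s,
    (Pi.single k 2 : Fin n → ℝ) ⬝ᵥ Pi.single l 2 = if k = l then 4 else 0 := by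
  intro k _ l _
  rw [single_dotProduct, Pi.single_apply]
  split_ifs <;> norm_num

/-- The change of signs at the coordinates where the word `z` is nonzero. -/
noncomputable def signFlip (z : Fin n → ZMod 2) : (Fin n → ℝ) ≃ₗ[ℝ] (Fin n → ℝ) :=
  multiRefl (Finset.univ.filter fun k => z k ≠ 0) (fun k => Pi.single k 2) (signFlip_aux _)

theorem signFlip_apply (z : Fin n → ZMod 2) (x : Fin n → ℝ) (i : Fin n) :
    signFlip z x i = x i - 2 * (liftWord z i * x i) := by
  rw [signFlip, multiRefl_apply, Pi.sub_apply, Finset.sum_apply]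
  have : ∀ k, ((x ⬝ᵥ Pi.single k 2 / 2) • (Pi.single k 2 : Fin n → ℝ)) i =
      if i = k then 2 * x k else 0 := fun k => by
    rw [dotProduct_single, Pi.smul_apply, Pi.single_apply]
    split_ifs <;> simp; ring
  simp only [this, Finset.sum_ite_eq, Finset.mem_filter, Finset.mem_univ, true_and, liftWord,
    zmod_two_val_eq_ite]
  split_ifs <;> simp

theorem signFlip_signFlip (z : Fin n → ZMod 2) (x : Fin n → ℝ) :
    signFlip z (signFlip z x) = x := multiRefl_multiRefl x

/-- The change of signs of an integer vector. -/
def intFlip (z : Fin n → ZMod 2) (m : Fin n → ℤ) : Fin n → ℤ :=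
  fun i => m i - 2 * (liftWord z i * m i)

theorem signFlip_intVec (z : Fin n → ZMod 2) (m : Fin n → ℤ) :
    signFlip z (intVec m) = intVec (intFlip z m) := by
  ext i; rw [signFlip_apply]; simp [intFlip]

theorem redMod_intFlip (z : Fin n → ZMod 2) (m : Fin n → ℤ) :
    redMod (intFlip z m) = redMod m := by
  ext i
  simp only [redMod, intFlip]
  push_cast
  rw [show (2 : ZMod 2) = 0 from rfl, zero_mul, sub_zero]

theorem sum_intFlip (z : Fin n → ZMod 2) (m : Fin n → ℤ) :
    ∑ i, intFlip z m i = ∑ i, m i - 2 * (liftWord z ⬝ᵥ m) := by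
  simp only [intFlip, Finset.sum_sub_distrib, dotProduct, Finset.mul_sum]

theorem signFlip_mem_shell {C : BinaryCode n} {z : Fin n → ZMod 2} (hz : z ∈ dualCode C) {r : ℤ}
    {x : Fin n → ℝ} (hx : x ∈ shell C r) : signFlip z x ∈ shell C r := by
  obtain ⟨m, rfl, h1, h2⟩ := hx
  rw [signFlip_intVec, intVec_mem_shell, redMod_intFlip, sum_intFlip]
  obtain ⟨a, ha⟩ := exists_dotProduct_eq_two_mul (m := liftWord z) (k := m) (by
    rw [redMod_liftWord]; exact hz _ h1)
  exact ⟨h1, by omega⟩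

theorem isLatIso_signFlip {C : BinaryCode n} {z : Fin n → ZMod 2} (hz : z ∈ dualCode C) :
    IsLatIso C C (signFlip z) :=
  isLatIso_multiRefl fun _ hx => signFlip_mem_shell hz hx

/-! ### Partitions into tetrads -/

/-- The indicator vector of a set of coordinates. -/
def ind (R : Type*) [Zero R] [One R] (t : Finset (Fin n)) : Fin n → R :=
  fun i => if i ∈ t then 1 else 0

theorem dotProduct_ind {R : Type*} [NonAssocSemiring R] (x : Fin n → R) (t : Finset (Fin n)) :
    x ⬝ᵥ ind R t = ∑ i ∈ t, x i := by
  simp [dotProduct, ind]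

theorem intVec_ind (t : Finset (Fin n)) : intVec (ind ℤ t) = ind ℝ t := by
  ext i; simp [ind]

theorem redMod_ind (t : Finset (Fin n)) : redMod (ind ℤ t) = ind (ZMod 2) t := by
  ext i; simp [ind, redMod]

theorem sum_ind {R : Type*} [NonAssocSemiring R] (t : Finset (Fin n)) :
    ∑ i, ind R t i = t.card := by
  simp [ind]

/-- `P` is a set of pairwise disjoint sets of four coordinates. -/
structure IsTetradFamily (P : Finset (Finset (Fin n))) : Prop where
  disj : ∀ s ∈ P, ∀ t ∈ P, s ≠ t → Disjoint s t
  card : ∀ t ∈ P, t.card = 4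

theorem IsTetradFamily.dotProduct {P : Finset (Finset (Fin n))} (hP : IsTetradFamily P) :
    ∀ s ∈ P, ∀ t ∈ P, ind ℝ s ⬝ᵥ ind ℝ t = if s = t then 4 else 0 := by
  intro s hs t ht
  rw [dotProduct_ind]
  simp only [ind, ← Finset.sum_filter, Finset.sum_const, Finset.filter_mem_eq_inter]
  split_ifs with h
  · subst h; simp [hP.card s hs]
  · rw [Finset.inter_comm, Finset.disjoint_iff_inter_eq_empty.1 (hP.disj s hs t ht h)]; simp

theorem IsTetradFamily.sum_eq {P : Finset (Finset (Fin n))} (hP : IsTetradFamily P)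
    (hcov : ∀ a, ∃ t ∈ P, a ∈ t) {M : Type*} [AddCommMonoid M] (f : Fin n → M) :
    ∑ i, f i = ∑ t ∈ P, ∑ i ∈ t, f i := by
  have : (Finset.univ : Finset (Fin n)) = P.biUnion id := by
    ext a; simpa using hcov a
  rw [this, Finset.sum_biUnion (t := id) fun s hs t ht h => hP.disj s hs t ht h]
  rfl

/-- The product of the reflections in the tetrads of a partition. -/
noncomputable def tetradRefl {P : Finset (Finset (Fin n))} (hP : IsTetradFamily P) :
    (Fin n → ℝ) ≃ₗ[ℝ] (Fin n → ℝ) :=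
  multiRefl P (ind ℝ) hP.dotProduct

theorem tetradRefl_tetradRefl {P : Finset (Finset (Fin n))} (hP : IsTetradFamily P)
    (x : Fin n → ℝ) : tetradRefl hP (tetradRefl hP x) = x := multiRefl_multiRefl x

theorem tetradRefl_apply {P : Finset (Finset (Fin n))} (hP : IsTetradFamily P) (x : Fin n → ℝ)
    {t : Finset (Fin n)} (ht : t ∈ P) {a : Fin n} (ha : a ∈ t) :
    tetradRefl hP x a = x a - (∑ i ∈ t, x i) / 2 := by
  rw [tetradRefl, multiRefl_apply, Pi.sub_apply, Finset.sum_apply, Finset.sum_eq_single t]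
  · simp [ind, ha, dotProduct_ind]
  · intro s hs hst
    have : a ∉ s := fun h => Finset.disjoint_left.1 (hP.disj s hs t ht hst) h ha
    simp [ind, this]
  · exact fun h => absurd ht h

theorem tetradRefl_single {P : Finset (Finset (Fin n))} (hP : IsTetradFamily P)
    {t : Finset (Fin n)} (ht : t ∈ P) {a : Fin n} (ha : a ∈ t) :
    tetradRefl hP (Pi.single a 2) = Pi.single a 2 - ind ℝ t := by
  rw [tetradRefl, multiRefl_apply, Finset.sum_eq_single t]
  · simp [ind, ha]
  · intro s hs hst
    have : a ∉ s := fun h => Finset.disjoint_left.1 (hP.disj s hs t ht hst) h ha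
    simp [ind, this]
  · exact fun h => absurd ht h

/-- The reflections in a partition into tetrads of the dual code which are congruent modulo the
code preserve the lattice. -/
theorem isLatIso_tetradRefl {C : BinaryCode n} {P : Finset (Finset (Fin n))}
    (hP : IsTetradFamily P) (hcov : ∀ a, ∃ t ∈ P, a ∈ t)
    (hdual : ∀ t ∈ P, ind (ZMod 2) t ∈ dualCode C)
    (hadd : ∀ s ∈ P, ∀ t ∈ P, ind (ZMod 2) s + ind (ZMod 2) t ∈ C) :
    IsLatIso C C (tetradRefl hP) := by
  refine isLatIso_multiRefl ?_
  rintro _ ⟨m, rfl, h1, h2⟩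
  have hk : ∀ t, ∃ k : ℤ, t ∈ P → ∑ i ∈ t, m i = 2 * k := fun t => by
    by_cases ht : t ∈ P
    · obtain ⟨k, hk⟩ := exists_dotProduct_eq_two_mul (m := m) (k := ind ℤ t) (by
        rw [redMod_ind, dotProduct_comm]; exact hdual t ht _ h1)
      exact ⟨k, fun _ => by rw [← hk, dotProduct_ind]⟩
    · exact ⟨0, fun h => absurd h ht⟩
  choose k hk using hk
  have hsum : ∑ i, m i = 2 * ∑ t ∈ P, k t := by
    rw [hP.sum_eq hcov, Finset.mul_sum]
    exact Finset.sum_congr rfl fun t ht => hk t ht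
  have heq : intVec m - ∑ t ∈ P, (intVec m ⬝ᵥ ind ℝ t / 2) • ind ℝ t =
      intVec (m - ∑ t ∈ P, k t • ind ℤ t) := by
    ext i
    simp only [Pi.sub_apply, Finset.sum_apply, intVec_apply, Pi.smul_apply, smul_eq_mul]
    push_cast
    congr 1
    refine Finset.sum_congr rfl fun t ht => ?_
    rw [← intVec_ind, intVec_dotProduct, dotProduct_ind, hk t ht]
    push_cast
    rw [intVec_apply]
    ring
  rw [multiRefl_apply, heq, intVec_mem_shell]
  constructor
  · rw [redMod_sub]
    refine C.sub_mem h1 ?_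
    have h3 : redMod (∑ t ∈ P, k t • ind ℤ t) = ∑ t ∈ P, (k t : ZMod 2) • ind (ZMod 2) t := by
      ext i
      simp [redMod, ind]
    rw [h3]
    rcases P.eq_empty_or_nonempty with rfl | ⟨t₀, ht₀⟩
    · simp
    have h4 : ∑ t ∈ P, (k t : ZMod 2) • ind (ZMod 2) t =
        ∑ t ∈ P, (k t : ZMod 2) • (ind (ZMod 2) t + ind (ZMod 2) t₀) := by
      have h5 : ∑ t ∈ P, (k t : ZMod 2) = 0 := by
        rw [← Int.cast_sum]
        exact (ZMod.intCast_zmod_eq_zero_iff_dvd _ 2).2 (by push_cast; omega)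
      simp only [smul_add, Finset.sum_add_distrib]
      rw [← Finset.sum_smul, h5, zero_smul, add_zero]
    rw [h4]
    exact C.sum_mem fun t ht => C.smul_mem _ (hadd t ht t₀ ht₀)
  · have h6 : ∑ i, (∑ t ∈ P, k t • ind ℤ t) i = ∑ t ∈ P, 4 * k t := by
      simp only [Finset.sum_apply, Pi.smul_apply, smul_eq_mul]
      rw [Finset.sum_comm]
      refine Finset.sum_congr rfl fun t ht => ?_
      rw [← Finset.mul_sum, sum_ind, hP.card t ht]
      push_cast; ring
    simp only [Pi.sub_apply, Finset.sum_sub_distrib, h6, ← Finset.mul_sum]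
    omega

/-! ### Orthogonal families in the frame class -/

theorem sq_eq_four_cases {m : Fin n → ℤ} (h : m ⬝ᵥ m = 4) :
    (∃ i, m = Pi.single i 2 ∨ m = Pi.single i (-2)) ∨ ∀ i, m i = 0 ∨ m i = 1 ∨ m i = -1 := by
  by_cases h2 : ∃ i, 2 ≤ |m i|
  · left
    obtain ⟨i, hi⟩ := h2
    refine ⟨i, ?_⟩
    have hsplit : m i * m i + ∑ j ∈ Finset.univ.erase i, m j * m j = 4 := by
      rw [Finset.add_sum_erase _ (fun j => m j * m j) (Finset.mem_univ i)]; exact h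
    have h4 : 4 ≤ m i * m i := by nlinarith [abs_mul_abs_self (m i)]
    have hnn : ∀ j ∈ Finset.univ.erase i, 0 ≤ m j * m j := fun j _ => mul_self_nonneg _
    have h0 := (Finset.sum_eq_zero_iff_of_nonneg hnn).1
      (le_antisymm (by linarith) (Finset.sum_nonneg hnn))
    have hz : ∀ j, j ≠ i → m j = 0 := fun j hj =>
      mul_self_eq_zero.1 (h0 j (Finset.mem_erase.2 ⟨hj, Finset.mem_univ j⟩))
    have hi2 : m i * m i = 4 := by
      have := Finset.sum_nonneg hnn
      linarith
    have : m i = 2 ∨ m i = -2 := by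
      have : (m i - 2) * (m i + 2) = 0 := by linarith
      rcases mul_eq_zero.1 this with h | h
      · left; linarith
      · right; linarith
    refine this.imp (fun h => ?_) fun h => ?_ <;>
    · ext j; by_cases hj : j = i
      · subst hj; simp [h]
      · simp [hj, hz j hj]
  · right
    push Not at h2
    intro i
    have := abs_lt.1 (h2 i)
    omega

theorem exists_single_of_mul_self {u : Fin n → ℝ} {m : Fin n → ℤ} (hu : u = intVec m) {i : Fin n}
    (h : m = Pi.single i 2 ∨ m = Pi.single i (-2)) :
    u = Pi.single i 2 ∨ u = -Pi.single i 2 := by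
  rcases h with rfl | rfl
  · left; rw [hu]; ext j; by_cases hj : j = i
    · subst hj; simp
    · simp [hj]
  · right; rw [hu]; ext j; by_cases hj : j = i
    · subst hj; simp
    · simp [hj]

/-- Reflection in a single integer vector of norm `4` belonging to the lattice. -/
theorem reflection_mem_shell {D : BinaryCode n} (hD : IsDoublyEven D) {m : Fin n → ℤ}
    (hm : intVec m ∈ shell D 0) {r : ℤ} {x : Fin n → ℝ} (hx : x ∈ shell D r) :
    x - (x ⬝ᵥ intVec m / 2) • intVec m ∈ shell D r := by
  obtain ⟨k, rfl, h1, h2⟩ := hx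
  have hx : intVec k ∈ shell D r := ⟨k, rfl, h1, h2⟩
  obtain ⟨a, ha⟩ := exists_dotProduct_eq_two_mul (hD.dotProduct_eq_zero h1 (intVec_mem_shell.1 hm).1)
  have h3 : intVec k ⬝ᵥ intVec m / 2 = (a : ℝ) := by
    rw [intVec_dotProduct, ha]; push_cast; ring
  rw [h3]
  simpa using sub_mem_shell hx (zsmul_mem_shell a hm)

/-- An orthogonal family of norm `4` vectors in the frame class can be moved into the standard
frame by an isometry of the lattice. -/
theorem exists_isLatIso_map_frame {D : BinaryCode n} (hD : IsDoublyEven D)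
    (U : Finset (Fin n → ℝ)) (hU : ∀ u ∈ U, u ∈ shell D 2) (hnorm : ∀ u ∈ U, u ⬝ᵥ u = 4)
    (horth : ∀ u ∈ U, ∀ v ∈ U, u ≠ v → u ⬝ᵥ v = 0) :
    ∃ w, IsLatIso D D w ∧ (∀ x ∈ shell D 2, w x ∈ shell D 2) ∧
      ∀ u ∈ U, ∃ i, w u = Pi.single i 2 ∨ w u = -Pi.single i 2 := by
  classical
  induction U using Finset.induction_on with
  | empty => exact ⟨LinearEquiv.refl ℝ _, ⟨fun _ _ => rfl, fun _ => Iff.rfl⟩, fun _ h => h, by simp⟩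
  | insert u U hu ih =>
    obtain ⟨w, hw, hw2, hwU⟩ := ih (fun v hv => hU v (Finset.mem_insert_of_mem hv))
      (fun v hv => hnorm v (Finset.mem_insert_of_mem hv))
      (fun v hv v' hv' => horth v (Finset.mem_insert_of_mem hv) v' (Finset.mem_insert_of_mem hv'))
    obtain ⟨m, hm, hm1, hm2⟩ := hw2 u (hU u (Finset.mem_insert_self u U))
    have hmm : m ⬝ᵥ m = 4 := by
      have := hw.dot u u
      rw [hnorm u (Finset.mem_insert_self u U), hm, intVec_dotProduct] at this
      exact_mod_cast this
    rcases sq_eq_four_cases hmm with ⟨i, hi⟩ | hcase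
    · refine ⟨w, hw, hw2, fun v hv => ?_⟩
      rcases Finset.mem_insert.1 hv with rfl | hv
      · exact ⟨i, exists_single_of_mul_self hm hi⟩
      · exact hwU v hv
    · obtain ⟨a, ha⟩ : ∃ a, m a ≠ 0 := by
        by_contra! h0
        simp [dotProduct, h0] at hmm
      have haa : m a * m a = 1 := by
        rcases hcase a with h | h | h
        · exact absurd h ha
        · rw [h]; rfl
        · rw [h]; rfl
      set v : Fin n → ℤ := m - Pi.single a (2 * m a) with hv
      have hvv : v ⬝ᵥ v = 4 := by
        simp only [hv, sub_dotProduct, dotProduct_sub, single_dotProduct, dotProduct_single,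
          Pi.sub_apply, Pi.single_eq_same, hmm]
        linarith
      have hmv : m ⬝ᵥ v = 2 := by
        simp only [hv, dotProduct_sub, dotProduct_single, hmm]
        linarith
      have hv0 : intVec v ∈ shell D 0 := by
        rw [intVec_mem_shell]
        constructor
        · rw [hv, redMod_sub]
          refine D.sub_mem hm1 ?_
          convert D.zero_mem
          ext j; by_cases hj : j = a
          · subst hj
            simp only [redMod, Pi.single_eq_same, Pi.zero_apply]
            push_cast
            rw [show (2 : ZMod 2) = 0 from rfl, zero_mul]
          · simp [redMod, hj]
        · have : ∑ i, v i = ∑ i, m i - 2 * m a := by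
            simp [hv]
          rw [this]
          rcases hcase a with h | h | h <;> rw [h] at ha ⊢ <;> omega
      have hrefl : ∀ k ∈ ({()} : Finset Unit), ∀ l ∈ ({()} : Finset Unit),
          intVec v ⬝ᵥ intVec v = if k = l then (4 : ℝ) else 0 := fun k _ l _ => by
        rw [intVec_dotProduct, hvv]; simp
      let ρ := multiRefl {()} (fun _ : Unit => intVec v) hrefl
      have hρ : ∀ x, ρ x = x - (x ⬝ᵥ intVec v / 2) • intVec v := fun x => by
        simp [ρ, multiRefl_apply]
      have hρiso : IsLatIso D D ρ := isLatIso_multiRefl fun x hx => by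
        change ρ x ∈ _
        rw [hρ]; exact reflection_mem_shell hD hv0 hx
      refine ⟨w.trans ρ, hw.trans hρiso, fun x hx => ?_, fun y hy => ?_⟩
      · rw [LinearEquiv.trans_apply, hρ]
        exact reflection_mem_shell hD hv0 (hw2 x hx)
      · rw [LinearEquiv.trans_apply]
        rcases Finset.mem_insert.1 hy with rfl | hy
        · refine ⟨a, ?_⟩
          have h1 : ρ (w y) = intVec (Pi.single a (2 * m a)) := by
            rw [hρ, hm, intVec_dotProduct, hmv, hv, intVec_sub]
            norm_num
          refine exists_single_of_mul_self h1 ?_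
          rcases hcase a with h | h | h
          · exact absurd h ha
          · left; rw [h]; rfl
          · right; rw [h]; rfl
        · obtain ⟨i, hi⟩ := hwU y hy
          refine ⟨i, ?_⟩
          have hyu : y ≠ u := fun h => hu (h ▸ hy)
          have h0 : w y ⬝ᵥ w u = 0 := by
            rw [hw.dot]
            exact horth y (Finset.mem_insert_of_mem hy) u (Finset.mem_insert_self u U) hyu
          have hmi : m i = 0 := by
            rw [hm] at h0
            rcases hi with hi | hi <;> rw [hi] at h0 <;> simpa using h0
          have hvi : v i = 0 := by
            have : i ≠ a := fun h => ha (h ▸ hmi)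
            simp [hv, hmi, this]
          have h1 : w y ⬝ᵥ intVec v = 0 := by
            rcases hi with hi | hi <;> rw [hi] <;> simp [hvi]
          rw [hρ, h1]
          simpa using hi

/-- An isometry matching the frame classes forces the codes to be equivalent. -/
theorem codeEquiv_of_map_shell_two {C D : BinaryCode n} (hC : IsDoublyEven C)
    (hD : IsDoublyEven D) {g} (hg : IsLatIso C D g) {x : Fin n → ℝ} (hx : x ∈ shell C 2)
    (hgx : g x ∈ shell D 2) : CodeEquiv C D := by
  classical
  obtain ⟨w, hw, hw2, hwU⟩ := exists_isLatIso_map_frame hD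
    (Finset.univ.image fun i : Fin n => g (Pi.single i 2))
    (by
      intro u hu
      obtain ⟨i, -, rfl⟩ := Finset.mem_image.1 hu
      exact hg.map_shell_two hx hgx (single_two_mem_shell C i))
    (by
      intro u hu
      obtain ⟨i, -, rfl⟩ := Finset.mem_image.1 hu
      rw [hg.dot]; simp; norm_num)
    (by
      intro u hu v hv huv
      obtain ⟨i, -, rfl⟩ := Finset.mem_image.1 hu
      obtain ⟨j, -, rfl⟩ := Finset.mem_image.1 hv
      have : j ≠ i := fun h => huv (by rw [h])
      rw [hg.dot]; simp [this])
  have hh := hg.trans hw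
  set h := g.trans w
  have hσ : ∀ i, ∃ j, h (Pi.single i 2) = Pi.single j 2 ∨ h (Pi.single i 2) = -Pi.single j 2 :=
    fun i => hwU _ (Finset.mem_image_of_mem _ (Finset.mem_univ i))
  choose σ hσ using hσ
  have hne : ∀ i, h (Pi.single i 2) (σ i) ≠ 0 := fun i => by
    rcases hσ i with h1 | h1 <;> rw [h1] <;> simp
  have hcoord : ∀ y i, h y (σ i) = y i ∨ h y (σ i) = -y i := by
    intro y i
    have h1 := hh.dot y (Pi.single i 2)
    rw [dotProduct_single] at h1
    rcases hσ i with h2 | h2 <;> rw [h2] at h1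
    · left; rw [dotProduct_single] at h1; linarith
    · right; rw [dotProduct_neg, dotProduct_single] at h1; linarith
  have hinj : Function.Injective σ := by
    intro i j hij
    by_contra hne'
    have h1 := hcoord (Pi.single i 2) j
    rw [← hij] at h1
    have : (Pi.single i 2 : Fin n → ℝ) j = 0 := by simp [Ne.symm hne']
    rw [this] at h1
    exact hne i (by simpa using h1)
  let τ : Equiv.Perm (Fin n) := Equiv.ofBijective σ (Finite.injective_iff_bijective.1 hinj)
  have hτ : ∀ i, τ i = σ i := fun _ => rfl
  have key : ∀ (m k : Fin n → ℤ), h (intVec m) = intVec k → redMod k ∘ τ = redMod m := by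
    intro m k hmk
    ext i
    simp only [Function.comp_apply, hτ, redMod]
    have h1 := hcoord (intVec m) i
    rw [hmk] at h1
    simp only [intVec_apply] at h1
    have h2 : k (σ i) = m i ∨ k (σ i) = - m i := by exact_mod_cast h1
    rcases h2 with h2 | h2 <;> rw [h2]
    push_cast
    exact ZMod.neg_eq_self_mod_two _
  refine ⟨τ.symm, ?_⟩
  ext c
  constructor
  · rintro ⟨b, hb, rfl⟩
    obtain ⟨k, hk, hk1, -⟩ := (hh.mem _).2 (intVec_liftWord_mem_shell hC hb)
    have := key _ _ hk
    rw [redMod_liftWord] at this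
    have h2 : (redMod k ∘ τ) ∘ τ.symm = redMod k := by ext i; simp
    rw [this] at h2
    change b ∘ τ.symm ∈ D
    rwa [h2]
  · intro hc
    obtain ⟨m, hm, hm1, -⟩ := (hh.symm.mem _).2 (intVec_liftWord_mem_shell hD hc)
    have h1 : h (intVec m) = intVec (liftWord c) := by rw [← hm, LinearEquiv.apply_symm_apply]
    have := key _ _ h1
    rw [redMod_liftWord] at this
    refine ⟨redMod m, hm1, ?_⟩
    simp only [← this]
    ext i; simp

theorem redMod_mem_dualCode {C D : BinaryCode n} (hC : IsDoublyEven C) (hD : IsDoublyEven D) {g}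
    (hg : IsLatIso C D g) {m : Fin n → ℤ} {r : ℤ} (hm : g (intVec m) ∈ shell D r) :
    redMod m ∈ dualCode C := by
  intro c hc
  obtain ⟨k, hk, hk1, -⟩ := hm
  obtain ⟨l, hl, hl1, -⟩ := (hg.mem _).2 (intVec_liftWord_mem_shell hC hc)
  have h1 := hg.dot (intVec m) (intVec (liftWord c))
  rw [hk, hl, intVec_dotProduct, intVec_dotProduct] at h1
  have h2 : k ⬝ᵥ l = m ⬝ᵥ liftWord c := by exact_mod_cast h1
  rw [← redMod_liftWord c, redMod_dotProduct, ← h2, ← redMod_dotProduct]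
  exact hD.dotProduct_eq_zero hk1 hl1

theorem ind_support_eq_redMod {m : Fin n → ℤ} (h : ∀ i, m i = 0 ∨ m i = 1 ∨ m i = -1) :
    ind (ZMod 2) (Finset.univ.filter fun i => m i ≠ 0) = redMod m := by
  ext i
  simp only [ind, redMod, Finset.mem_filter, Finset.mem_univ, true_and]
  rcases h i with h | h | h <;> rw [h] <;> rfl

theorem card_support_eq_four {m : Fin n → ℤ} (h : ∀ i, m i = 0 ∨ m i = 1 ∨ m i = -1)
    (hm : m ⬝ᵥ m = 4) : (Finset.univ.filter fun i => m i ≠ 0).card = 4 := by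
  have : m ⬝ᵥ m = ((Finset.univ.filter fun i => m i ≠ 0).card : ℤ) := by
    rw [Finset.card_filter]
    push_cast
    refine Finset.sum_congr rfl fun i _ => ?_
    rcases h i with h | h | h <;> rw [h] <;> rfl
  omega

theorem redMod_single_even {i : Fin n} {a : ℤ} (ha : (2 : ℤ) ∣ a) :
    redMod (Pi.single i a : Fin n → ℤ) = 0 := by
  ext j; by_cases hj : j = i
  · subst hj
    simp only [redMod, Pi.single_eq_same, Pi.zero_apply]
    exact (ZMod.intCast_zmod_eq_zero_iff_dvd _ 2).2 (by exact_mod_cast ha)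
  · simp [redMod, hj]

theorem intVec_single (i : Fin n) (a : ℤ) :
    intVec (Pi.single i a) = Pi.single i (a : ℝ) := by
  ext j; by_cases hj : j = i
  · subst hj; simp
  · simp [hj]

theorem tetradVector_dotProduct {P : Finset (Finset (Fin n))} (hP : IsTetradFamily P)
    {s t : Finset (Fin n)} (hs : s ∈ P) (ht : t ∈ P) {a b : Fin n} (ha : a ∈ s) (hb : b ∈ t) :
    (Pi.single a 2 - ind ℝ s) ⬝ᵥ (Pi.single b 2 - ind ℝ t) = if a = b then 4 else 0 := by
  have h1 : ∀ {s t : Finset (Fin n)}, s ∈ P → t ∈ P → ∀ {a}, a ∈ s →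
      (Pi.single a 2 : Fin n → ℝ) ⬝ᵥ ind ℝ t = if s = t then 2 else 0 := by
    intro s t hs ht a ha
    rw [single_dotProduct]
    by_cases h : s = t
    · subst h; simp [ind, ha]
    · have : a ∉ t := Finset.disjoint_left.1 (hP.disj s hs t ht h) ha
      simp [ind, this, h]
  rw [sub_dotProduct, dotProduct_sub, dotProduct_sub, h1 hs ht ha, dotProduct_comm (ind ℝ s),
    h1 ht hs hb, hP.dotProduct s hs t ht, single_dotProduct]
  by_cases h : a = b
  · subst h
    have : s = t := by
      by_contra hst
      exact Finset.disjoint_left.1 (hP.disj s hs t ht hst) ha hb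
    subst this
    simp; norm_num
  · by_cases hst : s = t
    · subst hst; simp [h]; norm_num
    · simp [h, hst, Ne.symm hst]

/-- A vector supported on a tetrad in the preimage of the frame class gives a partition of the
coordinates into congruent tetrads. -/
theorem exists_tetrad_partition {C D : BinaryCode n} (hD : IsDoublyEven D)
    {g} (hg : IsLatIso C D g) {m : Fin n → ℤ} (hsum : (4 : ℤ) ∣ ∑ i, m i - 2)
    (hmC : redMod m ∉ C) (hgm : g (intVec m) ∈ shell D 2) :
    ∃ P, IsTetradFamily P ∧ (∀ a, ∃ t ∈ P, a ∈ t) ∧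
      ∀ t ∈ P, ind (ZMod 2) t + redMod m ∈ C := by
  classical
  let Q : Finset (Finset (Fin n)) → Prop := fun P =>
    IsTetradFamily P ∧ ∀ t ∈ P, ind (ZMod 2) t + redMod m ∈ C
  obtain ⟨P, hPQ, hmax⟩ := Finset.exists_max_image (Finset.univ.filter Q) Finset.card
    ⟨∅, by simp only [Finset.mem_filter, Finset.mem_univ, true_and]; exact ⟨⟨by simp, by simp⟩, by simp⟩⟩
  obtain ⟨hP, hPC⟩ := (Finset.mem_filter.1 hPQ).2
  refine ⟨P, hP, ?_, hPC⟩
  by_contra! hcov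
  obtain ⟨a₀, ha₀⟩ := hcov
  set U : Finset (Fin n → ℝ) :=
    P.biUnion fun t => t.image fun a => g (Pi.single a 2 - ind ℝ t) with hUdef
  have hUmem : ∀ u ∈ U, ∃ t ∈ P, ∃ a ∈ t, u = g (Pi.single a 2 - ind ℝ t) := by
    intro u hu
    obtain ⟨t, ht, hu⟩ := Finset.mem_biUnion.1 hu
    obtain ⟨a, ha, rfl⟩ := Finset.mem_image.1 hu
    exact ⟨t, ht, a, ha, rfl⟩
  have hmemU : ∀ t ∈ P, ∀ a ∈ t, g (Pi.single a 2 - ind ℝ t) ∈ U := fun t ht a ha =>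
    Finset.mem_biUnion.2 ⟨t, ht, Finset.mem_image_of_mem _ ha⟩
  obtain ⟨w, hw, hw2, hwU⟩ := exists_isLatIso_map_frame hD U
    (by
      intro u hu
      obtain ⟨t, ht, a, ha, rfl⟩ := hUmem u hu
      have h1 : (Pi.single a 2 - ind ℝ t) - intVec m ∈ shell C 0 := by
        refine ⟨Pi.single a 2 - ind ℤ t - m, ?_, ?_, ?_⟩
        · rw [intVec_sub, intVec_sub, intVec_single, intVec_ind]; norm_num
        · rw [redMod_sub, redMod_sub, redMod_single_even (dvd_refl _), redMod_ind, zero_sub,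
            ← neg_add']
          exact C.neg_mem (hPC t ht)
        · have := hP.card t ht
          simp only [Pi.sub_apply, Finset.sum_sub_distrib, sum_ind, this, Finset.sum_pi_single']
          simp
          omega
      have := add_mem_shell ((hg.mem _).2 h1) hgm
      rwa [map_sub g _ (intVec m), sub_add_cancel, zero_add] at this)
    (by
      intro u hu
      obtain ⟨t, ht, a, ha, rfl⟩ := hUmem u hu
      rw [hg.dot, tetradVector_dotProduct hP ht ht ha ha, if_pos rfl])
    (by
      intro u hu v hv huv
      obtain ⟨t, ht, a, ha, rfl⟩ := hUmem u hu
      obtain ⟨s, hs, b, hb, rfl⟩ := hUmem v hv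
      rw [hg.dot, tetradVector_dotProduct hP ht hs ha hb, if_neg]
      rintro rfl
      have : t = s := by
        by_contra hst
        exact Finset.disjoint_left.1 (hP.disj t ht s hs hst) ha hb
      exact huv (by rw [this]))
  have hh := hg.trans hw
  set h := g.trans w with hhdef
  have hj : ∃ j, ∀ u ∈ U, ¬ (w u = Pi.single j 2 ∨ w u = -Pi.single j 2) := by
    by_contra! hall
    have h0 : h (Pi.single a₀ 1) = 0 := by
      ext j
      obtain ⟨u, hu, hj⟩ := hall j
      obtain ⟨t, ht, a, ha, rfl⟩ := hUmem u hu
      have h1 : h (Pi.single a₀ 1) ⬝ᵥ h (Pi.single a 2 - ind ℝ t) = 0 := by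
        rw [hh.dot, single_dotProduct, Pi.sub_apply, Pi.single_apply, if_neg]
        · simp [ind, ha₀ t ht]
        · rintro rfl; exact ha₀ t ht ha
      have h2 : h (Pi.single a 2 - ind ℝ t) = w (g (Pi.single a 2 - ind ℝ t)) := rfl
      rw [h2] at h1
      rcases hj with hj | hj <;> rw [hj] at h1 <;> simpa using h1
    have h3 := congrFun (h.map_eq_zero_iff.1 h0) a₀
    simp at h3
  obtain ⟨j, hj⟩ := hj
  have hf : h.symm (Pi.single j 2) - intVec m ∈ shell C 0 := by
    have h1 : h (intVec m) ∈ shell D 2 := hw2 _ hgm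
    have h2 := (hh.symm.mem _).2 (by simpa using sub_mem_shell (single_two_mem_shell D j) h1)
    rwa [map_sub, h.symm_apply_apply] at h2
  obtain ⟨l, hl, hl1, hl2⟩ := hf
  set k := l + m with hkdef
  have hk : h.symm (Pi.single j 2) = intVec k := by
    rw [hkdef, intVec_add, ← hl, sub_add_cancel]
  have hkm : redMod k + redMod m ∈ C := by
    rw [hkdef, redMod_add, add_assoc, word_add_self, add_zero]; exact hl1
  have hkk : k ⬝ᵥ k = 4 := by
    have := hh.symm.dot (Pi.single j 2) (Pi.single j 2)
    rw [hk, intVec_dotProduct] at this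
    have h4 : ((k ⬝ᵥ k : ℤ) : ℝ) = 4 := by rw [this]; simp; norm_num
    exact_mod_cast h4
  rcases sq_eq_four_cases hkk with ⟨i, hi⟩ | hcase
  · refine hmC ?_
    have : redMod k = 0 := by
      rcases hi with hi | hi <;> rw [hi] <;> exact redMod_single_even (by norm_num)
    rwa [this, zero_add] at hkm
  set t' := Finset.univ.filter fun i => k i ≠ 0 with ht'
  have hdisj : ∀ t ∈ P, Disjoint t' t := by
    intro t ht
    have h1 : ∀ a ∈ t, 2 * k a = ∑ i ∈ t, k i := by
      intro a ha
      have h2 : intVec k ⬝ᵥ (Pi.single a 2 - ind ℝ t) = 0 := by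
        rw [← hh.dot, ← hk, h.apply_symm_apply]
        have h3 : h (Pi.single a 2 - ind ℝ t) = w (g (Pi.single a 2 - ind ℝ t)) := rfl
        have h4 := hj _ (hmemU t ht a ha)
        rw [h3]
        obtain ⟨i, hi⟩ := hwU _ (hmemU t ht a ha)
        have hij : i ≠ j := by rintro rfl; exact h4 hi
        rcases hi with hi | hi <;> rw [hi] <;> simp [hij]
      rw [dotProduct_sub, dotProduct_ind, dotProduct_single] at h2
      simp only [intVec_apply] at h2
      have h5 : (k a : ℝ) * 2 = ∑ i ∈ t, (k i : ℝ) := by linarith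
      have h6 : k a * 2 = ∑ i ∈ t, k i := by exact_mod_cast h5
      linarith
    have h7 : 2 * ∑ i ∈ t, k i = 4 * ∑ i ∈ t, k i := by
      rw [Finset.mul_sum, Finset.sum_congr rfl h1, Finset.sum_const, hP.card t ht]
      simp
    refine Finset.disjoint_left.2 fun a ha hat => ?_
    have := h1 a hat
    rw [ht', Finset.mem_filter] at ha
    exact ha.2 (by omega)
  have hcard := card_support_eq_four hcase hkk
  have hnot : t' ∉ P := fun hin => by
    have := hdisj t' hin
    rw [disjoint_self] at this
    rw [← ht', this] at hcard
    simp at hcard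
  have hQ : Q (insert t' P) := by
    refine ⟨⟨?_, ?_⟩, ?_⟩
    · intro s hs t ht hst
      rcases Finset.mem_insert.1 hs with rfl | hs <;> rcases Finset.mem_insert.1 ht with rfl | ht
      · exact absurd rfl hst
      · exact hdisj t ht
      · exact (hdisj s hs).symm
      · exact hP.disj s hs t ht hst
    · intro t ht
      rcases Finset.mem_insert.1 ht with rfl | ht
      · exact hcard
      · exact hP.card t ht
    · intro t ht
      rcases Finset.mem_insert.1 ht with rfl | ht
      · rw [ind_support_eq_redMod hcase]; exact hkm
      · exact hPC t ht
  have := hmax _ (Finset.mem_filter.2 ⟨Finset.mem_univ _, hQ⟩)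
  rw [Finset.card_insert_of_notMem hnot] at this
  omega

theorem add_mem_of_add_mem {C : BinaryCode n} {x y d : Fin n → ZMod 2} (hx : x + d ∈ C)
    (hy : y + d ∈ C) : x + y ∈ C := by
  have := C.add_mem hx hy
  rwa [add_add_add_comm, word_add_self, add_zero] at this

theorem mem_dualCode_of_add_mem {C : BinaryCode n} (hC : IsDoublyEven C) {x d : Fin n → ZMod 2}
    (hx : x + d ∈ C) (hd : d ∈ dualCode C) : x ∈ dualCode C := by
  have := (dualCode C).add_mem (hC.le_dualCode hx) hd
  rwa [add_assoc, word_add_self, add_zero] at this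

theorem codeEquiv_of_map_tetrad {C D : BinaryCode n} (hC : IsDoublyEven C)
    (hD : IsDoublyEven D) {g} (hg : IsLatIso C D g) {m : Fin n → ℤ} (hmm : m ⬝ᵥ m = 4)
    (hsum : (4 : ℤ) ∣ ∑ i, m i - 2) (hmC : redMod m ∉ C)
    (hgm : g (intVec m) ∈ shell D 2) : CodeEquiv C D := by
  obtain ⟨P, hP, hcov, hPC⟩ := exists_tetrad_partition hD hg hsum hmC hgm
  have hdual := redMod_mem_dualCode hC hD hg hgm
  have h0 := isLatIso_tetradRefl hP hcov
    (fun t ht => mem_dualCode_of_add_mem hC (hPC t ht) hdual)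
    (fun s hs t ht => add_mem_of_add_mem (hPC s hs) (hPC t ht))
  obtain ⟨a, -⟩ : ∃ a, m a ≠ 0 := by
    by_contra! h0
    simp [dotProduct, h0] at hmm
  obtain ⟨t, ht, ha⟩ := hcov a
  refine codeEquiv_of_map_shell_two hC hD (h0.trans hg) (single_two_mem_shell C a) ?_
  rw [LinearEquiv.trans_apply, tetradRefl_single hP ht ha]
  have h1 : (Pi.single a 2 - ind ℝ t) - intVec m ∈ shell C 0 := by
    refine ⟨Pi.single a 2 - ind ℤ t - m, ?_, ?_, ?_⟩
    · rw [intVec_sub, intVec_sub, intVec_single, intVec_ind]; norm_num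
    · rw [redMod_sub, redMod_sub, redMod_single_even (dvd_refl _), redMod_ind, zero_sub,
        ← neg_add']
      exact C.neg_mem (hPC t ht)
    · have := hP.card t ht
      simp only [Pi.sub_apply, Finset.sum_sub_distrib, sum_ind, this]
      simp
      omega
  have := add_mem_shell ((hg.mem _).2 h1) hgm
  rwa [map_sub g _ (intVec m), sub_add_cancel, zero_add] at this

/-- If the preimage of the frame class contains an integer vector, the codes are equivalent. -/
theorem codeEquiv_of_map_intVec {C D : BinaryCode n} (hC : IsDoublyEven C)
    (hD : IsDoublyEven D) {g} (hg : IsLatIso C D g) {m : Fin n → ℤ}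
    (hgm : g (intVec m) ∈ shell D 2) : CodeEquiv C D := by
  obtain ⟨j, -⟩ : ∃ j : Fin n, True := by
    by_contra! hn
    obtain ⟨l, -, -, hl⟩ := hgm
    have : ∑ i, l i = 0 := Finset.sum_eq_zero fun i _ => (hn i).elim
    omega
  have hf : g.symm (Pi.single j 2) - intVec m ∈ shell C 0 := by
    have h2 := (hg.symm.mem _).2 (by simpa using sub_mem_shell (single_two_mem_shell D j) hgm)
    rwa [map_sub, g.symm_apply_apply] at h2
  obtain ⟨l, hl, -, -⟩ := hf
  set k := l + m with hkdef
  have hk : g.symm (Pi.single j 2) = intVec k := by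
    rw [hkdef, intVec_add, ← hl, sub_add_cancel]
  have hgk : g (intVec k) ∈ shell D 2 := by
    rw [← hk, g.apply_symm_apply]; exact single_two_mem_shell D j
  have hkk : k ⬝ᵥ k = 4 := by
    have := hg.symm.dot (Pi.single j 2) (Pi.single j 2)
    rw [hk, intVec_dotProduct] at this
    have h4 : ((k ⬝ᵥ k : ℤ) : ℝ) = 4 := by rw [this]; simp; norm_num
    exact_mod_cast h4
  have heven : (2 : ℤ) ∣ ∑ i, k i := by
    have h1 : ((k ⬝ᵥ k : ℤ) : ZMod 2) = ((∑ i, k i : ℤ) : ZMod 2) := by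
      rw [dotProduct]; push_cast
      refine Finset.sum_congr rfl fun i _ => ?_
      generalize (k i : ZMod 2) = a; revert a; decide
    rw [hkk] at h1
    exact (ZMod.intCast_zmod_eq_zero_iff_dvd _ 2).1 (h1.symm.trans (by decide))
  by_cases hkC : redMod k ∈ C
  · by_cases h2 : (4 : ℤ) ∣ ∑ i, k i - 2
    · exact codeEquiv_of_map_shell_two hC hD hg (intVec_mem_shell.2 ⟨hkC, h2⟩) hgk
    · have h3 : g (intVec k) ∈ shell D 0 :=
        (hg.mem _).2 (intVec_mem_shell.2 ⟨hkC, by omega⟩)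
      exact absurd h3 (not_mem_shell_of_mem hgk (by norm_num))
  · by_cases h2 : (4 : ℤ) ∣ ∑ i, k i - 2
    · exact codeEquiv_of_map_tetrad hC hD hg hkk h2 hkC hgk
    · obtain ⟨z, hz, hzk⟩ := exists_mem_dualCode_dotProduct_eq_one hkC
      have h1 : intVec (intFlip z k) = signFlip z (intVec k) := (signFlip_intVec z k).symm
      refine codeEquiv_of_map_tetrad hC hD ((isLatIso_signFlip hz).trans hg)
        (m := intFlip z k) ?_ ?_ ?_ ?_
      · have := (isLatIso_signFlip hz).dot (intVec k) (intVec k)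
        rw [← h1, intVec_dotProduct, intVec_dotProduct, hkk] at this
        exact_mod_cast this
      · rw [sum_intFlip]
        have h3 : ((liftWord z ⬝ᵥ k : ℤ) : ZMod 2) ≠ 0 := by
          rw [← redMod_dotProduct, redMod_liftWord, hzk]; exact one_ne_zero
        have h4 : ¬ (2 : ℤ) ∣ liftWord z ⬝ᵥ k := fun h =>
          h3 ((ZMod.intCast_zmod_eq_zero_iff_dvd _ 2).2 (by exact_mod_cast h))
        omega
      · rwa [redMod_intFlip]
      · rw [LinearEquiv.trans_apply, h1, signFlip_signFlip]; exact hgk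

/-! ### The MacWilliams identity and maximal doubly-even codes -/

/-- The sign of a bit. -/
def bitSign (a : ZMod 2) : ℤ := if a = 0 then 1 else -1

theorem bitSign_add (a b : ZMod 2) : bitSign (a + b) = bitSign a * bitSign b := by
  revert a b; decide

theorem bitSign_mul_self (a : ZMod 2) : bitSign a * bitSign a = 1 := by
  revert a; decide

theorem bitSign_sum {ι : Type*} (s : Finset ι) (f : ι → ZMod 2) :
    bitSign (∑ i ∈ s, f i) = ∏ i ∈ s, bitSign (f i) := by
  classical
  induction s using Finset.induction_on with
  | empty => rfl
  | insert a s ha ih => rw [Finset.sum_insert ha, Finset.prod_insert ha, bitSign_add, ih]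

theorem sum_bitSign (x : Fin n → ZMod 2) : ∑ i, bitSign (x i) = n - 2 * hammingNorm x := by
  have h : ∀ i, bitSign (x i) = 1 - 2 * liftWord x i := fun i => by
    simp only [liftWord]; generalize x i = a; revert a; decide
  simp only [h, Finset.sum_sub_distrib, ← Finset.mul_sum, sum_liftWord]
  simp

theorem sum_code_bitSign (C : BinaryCode n) [Fintype C] [DecidablePred (· ∈ dualCode C)]
    (x : Fin n → ZMod 2) :
    ∑ c : C, bitSign (x ⬝ᵥ c) = if x ∈ dualCode C then (Fintype.card C : ℤ) else 0 := by
  split_ifs with hx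
  · rw [Finset.sum_congr rfl fun c _ => by rw [hx c c.2]]
    simp [bitSign]
  · have : ∃ c ∈ C, x ⬝ᵥ c ≠ 0 := by
      by_contra! h
      exact hx h
    obtain ⟨c, hc, h⟩ := this
    have h1 : x ⬝ᵥ c = 1 := by
      revert h; generalize x ⬝ᵥ c = a; revert a; decide
    have h2 : ∑ b : C, bitSign (x ⬝ᵥ b) = ∑ b : C, -bitSign (x ⬝ᵥ b) := by
      rw [← Equiv.sum_comp (Equiv.addRight (⟨c, hc⟩ : C))]
      refine Finset.sum_congr rfl fun b _ => ?_
      simp only [Equiv.coe_addRight, Submodule.coe_add, dotProduct_add, bitSign_add, h1]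
      simp [bitSign]
    rw [Finset.sum_neg_distrib] at h2
    omega

theorem pow_hammingNorm {R : Type*} [CommMonoid R] (t : R) (x : Fin n → ZMod 2) :
    t ^ hammingNorm x = ∏ i, if x i = 0 then 1 else t := by
  rw [hammingNorm, ← Finset.prod_const, Finset.prod_filter]
  refine Finset.prod_congr rfl fun i _ => ?_
  by_cases h : x i = 0 <;> simp [h]

theorem sum_bitSign_mul_pow {R : Type*} [CommRing R] (t : R) (c : Fin n → ZMod 2) :
    ∑ x : Fin n → ZMod 2, (bitSign (x ⬝ᵥ c) : R) * t ^ hammingNorm x =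
      ∏ i, (1 + t * bitSign (c i)) := by
  have h1 : ∀ i, (1 + t * bitSign (c i) : R) =
      ∑ a : ZMod 2, (bitSign (a * c i) : R) * (if a = 0 then 1 else t) := fun i => by
    rw [show (Finset.univ : Finset (ZMod 2)) = {0, 1} from rfl]
    rw [Finset.sum_pair (by decide)]
    simp [bitSign]
  simp only [h1]
  rw [Finset.prod_univ_sum, Fintype.piFinset_univ]
  refine Finset.sum_congr rfl fun x _ => ?_
  rw [pow_hammingNorm, dotProduct, bitSign_sum, Int.cast_prod, Finset.prod_mul_distrib]

/-- The MacWilliams identity for the weight enumerator. -/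
theorem macWilliams {R : Type*} [CommRing R] (C : BinaryCode n) [Fintype C]
    [DecidablePred (· ∈ dualCode C)] (t : R) :
    (Fintype.card C : R) * ∑ x with x ∈ dualCode C, t ^ hammingNorm x =
      ∑ c : C, ∏ i, (1 + t * bitSign (c.1 i)) := by
  simp only [← sum_bitSign_mul_pow]
  rw [Finset.sum_comm, Finset.sum_filter, Finset.mul_sum]
  refine Finset.sum_congr rfl fun x _ => ?_
  rw [← Finset.sum_mul, ← Int.cast_sum, sum_code_bitSign]
  split_ifs <;> simp

theorem card_mul_card_dualCode (C : BinaryCode n) [Fintype C]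
    [DecidablePred (· ∈ dualCode C)] :
    Fintype.card C * (Finset.univ.filter (· ∈ dualCode C)).card = 2 ^ n := by
  have h := macWilliams C (1 : ℤ)
  simp only [one_pow, Finset.sum_const, nsmul_eq_mul, mul_one, one_mul] at h
  rw [Finset.sum_eq_single 0] at h
  · simp only [Submodule.coe_zero, Pi.zero_apply, bitSign, if_true] at h
    norm_num at h
    exact_mod_cast h
  · intro c _ hc
    have : ∃ i, c.1 i ≠ 0 := by
      by_contra! h0
      exact hc (Subtype.ext (funext h0))
    obtain ⟨i, hi⟩ := this
    exact Finset.prod_eq_zero (Finset.mem_univ i) (by simp [bitSign, hi])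
  · simp

theorem even_hammingNorm_of_one_mem {C : BinaryCode n} (h1 : (1 : Fin n → ZMod 2) ∈ C)
    {x : Fin n → ZMod 2} (hx : x ∈ dualCode C) : 2 ∣ hammingNorm x := by
  have := hx 1 h1
  rw [dotProduct_one] at this
  have h2 : ((hammingNorm x : ℕ) : ZMod 2) = 0 := by
    rw [← word_dotProduct_self, ← this, dotProduct]
    refine Finset.sum_congr rfl fun i _ => ?_
    generalize x i = a; revert a; decide
  exact (ZMod.natCast_eq_zero_iff _ 2).1 h2

/-- A doubly-even code of length divisible by `8` which contains the all-one word and is not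
self-dual can be enlarged to a doubly-even code. -/
theorem exists_doublyEven_extension {C : BinaryCode n} (hC : IsDoublyEven C)
    (h1 : (1 : Fin n → ZMod 2) ∈ C) (hn : 8 ∣ n) (hsd : ¬ IsSelfDual C) :
    ∃ d ∈ dualCode C, d ∉ C ∧ 4 ∣ hammingNorm d := by
  classical
  by_contra! hall
  obtain ⟨q, rfl⟩ := hn
  set a := Fintype.card C with ha
  set F := Finset.univ.filter (· ∈ dualCode C) with hF
  have hab : a * F.card = 2 ^ (8 * q) := card_mul_card_dualCode C
  have ha' : a = (Finset.univ.filter (· ∈ C)).card := by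
    rw [ha, Fintype.card_subtype]
  have hmac := macWilliams C Complex.I
  have hprod : ∀ c : C, ∏ i, (1 + Complex.I * (bitSign (c.1 i) : ℂ)) = 16 ^ q := by
    intro c
    have h2 : ∀ i, (1 + Complex.I * (bitSign (c.1 i) : ℂ)) =
        (1 + Complex.I) * (if c.1 i = 0 then 1 else -Complex.I) := by
      intro i
      by_cases h : c.1 i = 0
      · simp [bitSign, h]
      · simp only [bitSign, h, if_false]
        push_cast
        linear_combination Complex.I_mul_I
    simp only [h2, Finset.prod_mul_distrib, ← pow_hammingNorm]
    obtain ⟨w, hw⟩ := hC c c.2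
    have h3 : (-Complex.I) ^ 4 = 1 := by rw [neg_pow, Complex.I_pow_four]; norm_num
    have h4 : (1 + Complex.I) ^ 8 = 16 := by
      have : (1 + Complex.I) ^ 2 = 2 * Complex.I := by linear_combination Complex.I_sq
      rw [show (8 : ℕ) = 2 * 4 from rfl, pow_mul, this, mul_pow, Complex.I_pow_four]; norm_num
    rw [hw, pow_mul, h3, one_pow, mul_one, Finset.prod_const, Finset.card_univ, Fintype.card_fin,
      pow_mul, h4]
  have hterm : ∀ x ∈ F, Complex.I ^ hammingNorm x = if x ∈ C then 1 else -1 := by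
    intro x hx
    have hxd := (Finset.mem_filter.1 hx).2
    split_ifs with hxC
    · obtain ⟨w, hw⟩ := hC x hxC
      rw [hw, pow_mul, Complex.I_pow_four, one_pow]
    · have h5 := hall x hxd hxC
      obtain ⟨w, hw⟩ := even_hammingNorm_of_one_mem h1 hxd
      have hodd : Odd w := by
        rw [← Nat.not_even_iff_odd]
        rintro ⟨v, rfl⟩
        exact h5 ⟨v, by omega⟩
      rw [hw, pow_mul, Complex.I_sq, hodd.neg_one_pow]
  rw [Finset.sum_congr rfl hterm, Finset.sum_congr rfl fun c _ => hprod c] at hmac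
  simp only [Finset.sum_const, Finset.card_univ, nsmul_eq_mul, ← ha] at hmac
  have ha0 : (a : ℂ) ≠ 0 := by
    have : 0 < a := Fintype.card_pos
    exact_mod_cast this.ne'
  replace hmac := mul_left_cancel₀ ha0 hmac
  have hsplit : ∑ x ∈ F, (if x ∈ C then (1 : ℂ) else -1) = 2 * a - F.card := by
    have h6 : ∀ x ∈ F, (if x ∈ C then (1 : ℂ) else -1) = 2 * (if x ∈ C then 1 else 0) - 1 := by
      intro x _; split_ifs <;> norm_num
    rw [Finset.sum_congr rfl h6, Finset.sum_sub_distrib, ← Finset.mul_sum, ← Finset.sum_filter,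
      Finset.sum_const, Finset.sum_const, ha', hF, Finset.filter_filter]
    have : Finset.univ.filter (fun x => x ∈ dualCode C ∧ x ∈ C) = Finset.univ.filter (· ∈ C) :=
      Finset.filter_congr fun x _ => ⟨fun h => h.2, fun h => ⟨hC.le_dualCode h, h⟩⟩
    rw [this]; simp
  rw [hsplit] at hmac
  have hmac' : 2 * (a : ℤ) - F.card = 16 ^ q := by exact_mod_cast hmac
  have hab' : (a : ℤ) * F.card = 16 ^ q * 16 ^ q := by
    rw [← mul_pow, ← Nat.cast_mul, hab, pow_mul]; norm_num
  have hy : (0 : ℤ) < 16 ^ q := by positivity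
  have hfac : (2 * (a : ℤ) + 16 ^ q) * (a - 16 ^ q) = 0 := by
    have : (F.card : ℤ) = 2 * a - 16 ^ q := by linarith
    rw [this] at hab'
    linear_combination hab'
  have hay : (a : ℤ) = 16 ^ q := by
    rcases mul_eq_zero.1 hfac with h | h
    · have : (0 : ℤ) ≤ a := Int.natCast_nonneg a
      linarith
    · linarith
  have hFa : F.card = a := by
    have : (F.card : ℤ) = a := by linarith
    exact_mod_cast this
  have hsub : Finset.univ.filter (· ∈ C) ⊆ F := fun x hx =>
    Finset.mem_filter.2 ⟨Finset.mem_univ x, hC.le_dualCode (Finset.mem_filter.1 hx).2⟩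
  have heq := Finset.eq_of_subset_of_card_le hsub (by rw [← ha', hFa])
  refine hsd (le_antisymm (fun x hx => ?_) hC.le_dualCode)
  have : x ∈ F := Finset.mem_filter.2 ⟨Finset.mem_univ x, hx⟩
  rw [← heq] at this
  exact (Finset.mem_filter.1 this).2

/-! ### Tetrad partitions from Hadamard matrices of order `16` -/

theorem hammingNorm_add_one (x : Fin n → ZMod 2) :
    hammingNorm (x + 1) + hammingNorm x = n := by
  have h1 := sum_bitSign (x + 1)
  have h2 := sum_bitSign x
  have h3 : ∀ i, bitSign ((x + 1) i) = - bitSign (x i) := fun i => by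
    simp only [Pi.add_apply, Pi.one_apply]
    generalize x i = a; revert a; decide
  simp only [h3, Finset.sum_neg_distrib, h2] at h1
  omega

theorem ind_support (x : Fin n → ZMod 2) :
    ind (ZMod 2) (Finset.univ.filter fun i => x i ≠ 0) = x := by
  ext i
  simp only [ind, Finset.mem_filter, Finset.mem_univ, true_and]
  generalize x i = a; revert a; decide

theorem hadamard_column_orthogonality (r : Fin n → Fin n → ZMod 2)
    (h : ∀ i j, i ≠ j → 2 * hammingNorm (r i + r j) = n) (a b : Fin n) :
    ∑ i, bitSign (r i a) * bitSign (r i b) = if a = b then (n : ℤ) else 0 := by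
  let S : Matrix (Fin n) (Fin n) ℚ := fun i a => (bitSign (r i a) : ℚ)
  have hn : (n : ℚ) ≠ 0 := by
    have := a.pos
    exact_mod_cast this.ne'
  have h1 : ((n : ℚ)⁻¹ • S) * S.transpose = 1 := by
    ext i j
    have h2 : (S * S.transpose) i j = ((∑ a, bitSign ((r i + r j) a) : ℤ) : ℚ) := by
      rw [Matrix.mul_apply]
      push_cast
      refine Finset.sum_congr rfl fun a _ => ?_
      simp only [S, Pi.add_apply, bitSign_add]
      push_cast; rfl
    rw [Matrix.smul_mul, Matrix.smul_apply, h2, smul_eq_mul, Matrix.one_apply, sum_bitSign]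
    split_ifs with hij
    · subst hij
      rw [word_add_self]
      simp [hn]
    · have := h i j hij
      have h3 : (n : ℤ) - 2 * (hammingNorm (r i + r j) : ℤ) = 0 := by omega
      rw [h3]; simp
  have h4 := mul_eq_one_comm.1 h1
  have h5 := congrFun (congrFun h4 a) b
  rw [Matrix.mul_smul, Matrix.smul_apply, Matrix.mul_apply, smul_eq_mul, Matrix.one_apply,
    inv_mul_eq_iff_eq_mul₀ hn] at h5
  have h6 : ((∑ i, bitSign (r i a) * bitSign (r i b) : ℤ) : ℚ) =
      ((if a = b then (n : ℤ) else 0 : ℤ) : ℚ) := by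
    push_cast
    refine Eq.trans h5 ?_
    split_ifs <;> simp
  exact_mod_cast h6

theorem exists_tetrad_partition_of_hadamard {C : BinaryCode n} (hC : IsDoublyEven C)
    (hn : n = 16) (h1 : (1 : Fin n → ZMod 2) ∈ C) (r : Fin n → Fin n → ZMod 2)
    (hr : ∀ i j, r i + r j ∈ C) (hw : ∀ i j, i ≠ j → 2 * hammingNorm (r i + r j) = n)
    {d : Fin n → ZMod 2} (hd : d ∈ dualCode C) (hdC : d ∉ C) (hd4 : 4 ∣ hammingNorm d) :
    ∃ P, IsTetradFamily P ∧ (∀ a, ∃ t ∈ P, a ∈ t) ∧ ∀ t ∈ P, ind (ZMod 2) t + d ∈ C := by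
  classical
  let i₀ : Fin n := ⟨0, by omega⟩
  have hcol := hadamard_column_orthogonality r hw
  set u : Fin n → Fin n → ZMod 2 := fun i => d + (r i₀ + r i) with hu
  have hud : ∀ i, u i + d ∈ C := fun i => by
    have : u i + d = r i₀ + r i := by
      rw [hu]; simp only
      rw [add_comm d, add_assoc, word_add_self, add_zero]
    rw [this]; exact hr _ _
  have hu4 : ∀ i, 4 ∣ hammingNorm (u i) := fun i =>
    (four_dvd_hammingNorm_add_iff hd4 (hC _ (hr i₀ i))).2 (hd _ (hr i₀ i))
  have huC : ∀ i, u i ∉ C := fun i hi => hdC (by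
    have := C.add_mem hi (hud i)
    rwa [← add_assoc, word_add_self, zero_add] at this)
  have hu0 : ∀ i, hammingNorm (u i) ≠ 0 := fun i h0 => huC i (by
    rw [hammingNorm_eq_zero.1 h0]; exact C.zero_mem)
  have hu16 : ∀ i, hammingNorm (u i + 1) ≠ 0 := fun i h0 => huC i (by
    have h2 := C.add_mem (hammingNorm_eq_zero.1 h0 ▸ C.zero_mem : u i + 1 ∈ C) h1
    rwa [add_assoc, word_add_self, add_zero] at h2)
  set q : Fin n → ℤ := fun i => ∑ a, bitSign (u i a) with hq
  have hqval : ∀ i, q i = 16 - 2 * hammingNorm (u i) := fun i => by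
    rw [hq]; simp only; rw [sum_bitSign]; omega
  have hqcases : ∀ i, q i = 0 ∨ q i = 8 ∨ q i = -8 := by
    intro i
    have h2 := hqval i
    have h3 := hu4 i
    have h4 := hu0 i
    have h5 := hu16 i
    have h6 := hammingNorm_add_one (u i)
    omega
  have hqsum : ∀ a, ∑ i, q i * bitSign (u i a) = 16 := by
    intro a
    have h2 : ∀ i, q i * bitSign (u i a) =
        ∑ b, (bitSign ((d + r i₀) b) * bitSign ((d + r i₀) a)) *
          (bitSign (r i b) * bitSign (r i a)) := by
      intro i
      rw [hq]; simp only
      rw [Finset.sum_mul]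
      refine Finset.sum_congr rfl fun b _ => ?_
      simp only [hu, Pi.add_apply, bitSign_add]; ring
    simp only [h2]
    rw [Finset.sum_comm]
    simp only [← Finset.mul_sum, hcol, mul_ite, mul_zero, Finset.sum_ite_eq', Finset.mem_univ,
      if_true, bitSign_mul_self, hn]
    norm_num
  set J := Finset.univ.filter fun i => q i ≠ 0 with hJ
  have hJcard : J.card = 4 := by
    have h2 : ∑ i, q i * q i = 256 := by
      have : ∀ i, q i * q i = ∑ a, q i * bitSign (u i a) := fun i => by
        rw [← Finset.mul_sum]
      simp only [this]
      rw [Finset.sum_comm]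
      simp only [hqsum]
      simp [hn]
    have h3 : ∑ i, q i * q i = 64 * J.card := by
      rw [hJ, Finset.card_filter]
      push_cast
      rw [Finset.mul_sum]
      refine Finset.sum_congr rfl fun i _ => ?_
      rcases hqcases i with h | h | h <;> simp [h]
    omega
  let T : Fin n → Fin n → ZMod 2 := fun i => if q i = 8 then u i else u i + 1
  have hTd : ∀ i, T i + d ∈ C := by
    intro i
    simp only [T]
    split_ifs
    · exact hud i
    · rw [add_right_comm]; exact C.add_mem (hud i) h1
  have hT4 : ∀ i ∈ J, hammingNorm (T i) = 4 := by
    intro i hi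
    have h2 := hqval i
    have h3 := (Finset.mem_filter.1 hi).2
    have h6 := hammingNorm_add_one (u i)
    simp only [T]
    split_ifs with h
    · omega
    · rcases hqcases i with h' | h' | h'
      · exact absurd h' h3
      · exact absurd h' h
      · omega
  have hTsum : ∀ a, ∑ i ∈ J, bitSign (T i a) = 2 := by
    intro a
    have h2 : ∀ i ∈ J, 8 * bitSign (T i a) = q i * bitSign (u i a) := by
      intro i hi
      have h3 := (Finset.mem_filter.1 hi).2
      simp only [T]
      split_ifs with h
      · rw [h]
      · rcases hqcases i with h' | h' | h'
        · exact absurd h' h3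
        · exact absurd h' h
        · rw [h', Pi.add_apply, bitSign_add, Pi.one_apply, show bitSign 1 = -1 from rfl]; ring
    have h4 : 8 * ∑ i ∈ J, bitSign (T i a) = 16 := by
      rw [Finset.mul_sum, Finset.sum_congr rfl h2, ← hqsum a, hJ, Finset.sum_filter]
      refine Finset.sum_congr rfl fun i _ => ?_
      by_cases h : q i = 0 <;> simp [h]
    omega
  have huniq : ∀ a, (J.filter fun i => T i a ≠ 0).card = 1 := by
    intro a
    have h2 : ∑ i ∈ J, bitSign (T i a) = J.card - 2 * (J.filter fun i => T i a ≠ 0).card := by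
      rw [Finset.card_filter (fun i => T i a ≠ 0) J, Finset.card_eq_sum_ones]
      push_cast
      rw [Finset.mul_sum, ← Finset.sum_sub_distrib]
      refine Finset.sum_congr rfl fun i _ => ?_
      by_cases h : T i a = 0 <;> simp [h, bitSign]
    have := hTsum a
    omega
  refine ⟨J.image fun i => Finset.univ.filter fun a => T i a ≠ 0, ⟨?_, ?_⟩, ?_, ?_⟩
  · intro s hs t ht hst
    obtain ⟨i, hi, rfl⟩ := Finset.mem_image.1 hs
    obtain ⟨j, hj, rfl⟩ := Finset.mem_image.1 ht
    refine Finset.disjoint_left.2 fun a ha hb => hst ?_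
    obtain ⟨l, hl⟩ := Finset.card_eq_one.1 (huniq a)
    have h2 : i ∈ ({l} : Finset (Fin n)) :=
      hl ▸ Finset.mem_filter.2 ⟨hi, (Finset.mem_filter.1 ha).2⟩
    have h3 : j ∈ ({l} : Finset (Fin n)) :=
      hl ▸ Finset.mem_filter.2 ⟨hj, (Finset.mem_filter.1 hb).2⟩
    rw [Finset.mem_singleton.1 h2, Finset.mem_singleton.1 h3]
  · intro t ht
    obtain ⟨i, hi, rfl⟩ := Finset.mem_image.1 ht
    exact hT4 i hi
  · intro a
    obtain ⟨l, hl⟩ := Finset.card_eq_one.1 (huniq a)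
    have h2 : l ∈ J.filter fun i => T i a ≠ 0 := hl ▸ Finset.mem_singleton_self l
    obtain ⟨h3, h4⟩ := Finset.mem_filter.1 h2
    exact ⟨_, Finset.mem_image_of_mem _ h3, Finset.mem_filter.2 ⟨Finset.mem_univ a, h4⟩⟩
  · intro t ht
    obtain ⟨i, hi, rfl⟩ := Finset.mem_image.1 ht
    rw [ind_support]; exact hTd i

/-! ### Isometries whose frame is half-integral -/

theorem codeEquiv_of_half_odd_aux {C D : BinaryCode n} (hC : IsDoublyEven C) (hD : IsDoublyEven D)
    {g} (hg : IsLatIso C D g) {k : Fin n → ℤ} (hk : ∀ a, Odd (k a))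
    (hgk : g ((1 / 2 : ℝ) • intVec k) ∈ shell D 2) {P : Finset (Finset (Fin n))}
    (hP : IsTetradFamily P) (hcov : ∀ a, ∃ t ∈ P, a ∈ t) {d : Fin n → ZMod 2}
    (hd : d ∈ dualCode C) (hPC : ∀ t ∈ P, ind (ZMod 2) t + d ∈ C)
    (hsum : ∀ t ∈ P, (4 : ℤ) ∣ ∑ i ∈ t, k i - 2) : CodeEquiv C D := by
  have h0 := isLatIso_tetradRefl hP hcov
    (fun t ht => mem_dualCode_of_add_mem hC (hPC t ht) hd)
    (fun s hs t ht => add_mem_of_add_mem (hPC s hs) (hPC t ht))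
  have hm : ∀ a, ∃ m : ℤ, tetradRefl hP ((1 / 2 : ℝ) • intVec k) a = m := by
    intro a
    obtain ⟨t, ht, ha⟩ := hcov a
    obtain ⟨c, hc⟩ := hsum t ht
    obtain ⟨l, hl⟩ := hk a
    refine ⟨l - c, ?_⟩
    rw [tetradRefl_apply hP _ ht ha]
    simp only [Pi.smul_apply, intVec_apply, smul_eq_mul]
    rw [← Finset.mul_sum, ← Int.cast_sum, show ∑ i ∈ t, k i = 4 * c + 2 by linarith, hl]
    push_cast; ring
  choose m hm using hm
  have hm' : tetradRefl hP ((1 / 2 : ℝ) • intVec k) = intVec m := funext hm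
  refine codeEquiv_of_map_intVec hC hD (h0.trans hg) (m := m) ?_
  rw [LinearEquiv.trans_apply, ← hm', tetradRefl_tetradRefl]
  exact hgk

theorem codeEquiv_of_half_odd {C D : BinaryCode n} (hC : IsDoublyEven C) (hD : IsDoublyEven D)
    {g} (hg : IsLatIso C D g) {k : Fin n → ℤ} (hk : ∀ a, Odd (k a)) {j : Fin n}
    (hgk : g ((1 / 2 : ℝ) • intVec k) = Pi.single j 2) {P : Finset (Finset (Fin n))}
    (hP : IsTetradFamily P) (hcov : ∀ a, ∃ t ∈ P, a ∈ t) {d : Fin n → ZMod 2}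
    (hd : d ∈ dualCode C) (hdC : d ∉ C) (hPC : ∀ t ∈ P, ind (ZMod 2) t + d ∈ C) :
    CodeEquiv C D := by
  have heven : ∀ t ∈ P, (2 : ℤ) ∣ ∑ i ∈ t, k i := by
    intro t ht
    have h1 : ((∑ i ∈ t, k i : ℤ) : ZMod 2) = 0 := by
      push_cast
      have : ∀ i ∈ t, (k i : ZMod 2) = 1 := fun i _ => by
        obtain ⟨l, hl⟩ := hk i
        rw [hl]; push_cast
        rw [show (2 : ZMod 2) = 0 from rfl, zero_mul, zero_add]
      rw [Finset.sum_congr rfl this, Finset.sum_const, hP.card t ht]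
      decide
    exact (ZMod.intCast_zmod_eq_zero_iff_dvd _ 2).1 h1
  have hpar : ∀ s ∈ P, ∀ t ∈ P, (4 : ℤ) ∣ ∑ i ∈ s, k i + ∑ i ∈ t, k i := by
    intro s hs t ht
    have h1 : intVec (ind ℤ s + ind ℤ t) ∈ shell C 0 := by
      rw [intVec_mem_shell, redMod_add, redMod_ind, redMod_ind]
      refine ⟨add_mem_of_add_mem (hPC s hs) (hPC t ht), ?_⟩
      simp only [Pi.add_apply, Finset.sum_add_distrib, sum_ind, hP.card s hs, hP.card t ht]
      norm_num
    obtain ⟨l, hl, -, -⟩ := (hg.mem _).2 h1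
    have h2 := hg.dot ((1 / 2 : ℝ) • intVec k) (intVec (ind ℤ s + ind ℤ t))
    rw [hgk, hl, smul_dotProduct, intVec_dotProduct, single_dotProduct, dotProduct_add,
      dotProduct_ind, dotProduct_ind, intVec_apply, smul_eq_mul] at h2
    have h3 : (4 : ℝ) * (l j : ℝ) = ((∑ i ∈ s, k i + ∑ i ∈ t, k i : ℤ) : ℝ) := by linarith
    exact ⟨l j, by exact_mod_cast h3.symm⟩
  have hgk2 : g ((1 / 2 : ℝ) • intVec k) ∈ shell D 2 := hgk ▸ single_two_mem_shell D j
  by_cases hall : ∀ t ∈ P, (4 : ℤ) ∣ ∑ i ∈ t, k i - 2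
  · exact codeEquiv_of_half_odd_aux hC hD hg hk hgk2 hP hcov hd hPC hall
  · push Not at hall
    obtain ⟨s, hs, hs4⟩ := hall
    obtain ⟨z, hz, hzd⟩ := exists_mem_dualCode_dotProduct_eq_one hdC
    refine codeEquiv_of_half_odd_aux hC hD ((isLatIso_signFlip hz).trans hg) (k := intFlip z k)
      (fun a => ?_) ?_ hP hcov hd hPC fun t ht => ?_
    · rw [intFlip]; exact (hk a).sub_even (even_two_mul _)
    · rw [LinearEquiv.trans_apply, map_smul, ← signFlip_intVec, signFlip_signFlip]
      exact hgk2
    · have h1 : z ⬝ᵥ ind (ZMod 2) t = 1 := by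
        have := hz _ (hPC t ht)
        rw [dotProduct_add, hzd] at this
        revert this; generalize z ⬝ᵥ ind (ZMod 2) t = a; revert a; decide
      have h2 : ((∑ i ∈ t, liftWord z i * k i : ℤ) : ZMod 2) = 1 := by
        rw [← h1, dotProduct_ind]
        push_cast
        refine Finset.sum_congr rfl fun i _ => ?_
        obtain ⟨l, hl⟩ := hk i
        have h3 : ((liftWord z i : ℤ) : ZMod 2) = z i := congrFun (redMod_liftWord z) i
        rw [hl, h3]; push_cast
        rw [show (2 : ZMod 2) = 0 from rfl, zero_mul, zero_add, mul_one]
      have h4 : ¬ (2 : ℤ) ∣ ∑ i ∈ t, liftWord z i * k i := fun h => by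
        rw [(ZMod.intCast_zmod_eq_zero_iff_dvd _ 2).2 (by exact_mod_cast h)] at h2
        exact zero_ne_one h2
      have h5 : ∑ i ∈ t, intFlip z k i = ∑ i ∈ t, k i - 2 * ∑ i ∈ t, liftWord z i * k i := by
        simp only [intFlip, Finset.sum_sub_distrib, Finset.mul_sum]
      rw [h5]
      have h6 := hpar s hs t ht
      have h7 := heven s hs
      omega

/-- The frame vectors pulled back along an isometry are half-integral with all doubled coordinates
of the same parity. -/
theorem exists_frame_eq_half {C D : BinaryCode n} {g} (hg : IsLatIso C D g) (j : Fin n) :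
    ∃ k : Fin n → ℤ, g.symm (Pi.single j 2) = (1 / 2 : ℝ) • intVec k ∧
      ∀ a b, Even (k a + k b) := by
  have hdual : ∀ x ∈ shell C 0, ∃ l : ℤ, g.symm (Pi.single j 2) ⬝ᵥ x = 2 * l := by
    intro x hx
    obtain ⟨l, hl, -, -⟩ := (hg.mem x).2 hx
    refine ⟨l j, ?_⟩
    rw [← hg.dot, g.apply_symm_apply, hl, single_dotProduct, intVec_apply]
  have hpair : ∀ a b, ∃ l : ℤ, g.symm (Pi.single j 2) a + g.symm (Pi.single j 2) b = l := by
    intro a b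
    obtain ⟨l, hl⟩ := hdual _ (shell_congr (s := 0)
      (add_mem_shell (single_two_mem_shell C a) (single_two_mem_shell C b)) (by norm_num))
    refine ⟨l, ?_⟩
    rw [dotProduct_add, dotProduct_single, dotProduct_single] at hl
    linarith
  choose l hl using hpair
  refine ⟨fun a => l a a, ?_, fun a b => ⟨l a b, ?_⟩⟩
  · ext a
    have := hl a a
    simp only [Pi.smul_apply, intVec_apply, smul_eq_mul]
    linarith
  · have h1 := hl a a
    have h2 := hl b b
    have h3 := hl a b
    have : (l a a + l b b : ℝ) = l a b + l a b := by linarith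
    exact_mod_cast this

theorem frame_cases {C D : BinaryCode n} (hC : IsDoublyEven C) (hD : IsDoublyEven D)
    {g} (hg : IsLatIso C D g) : CodeEquiv C D ∨
      ∃ k : Fin n → Fin n → ℤ, (∀ j, g.symm (Pi.single j 2) = (1 / 2 : ℝ) • intVec (k j)) ∧
        ∀ j a, Odd (k j a) := by
  choose k hk hpar using fun j => exists_frame_eq_half hg j
  by_cases h : ∀ j a, Odd (k j a)
  · exact Or.inr ⟨k, hk, h⟩
  · left
    push Not at h
    obtain ⟨j, a, hja⟩ := h
    rw [Int.not_odd_iff_even] at hja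
    have heven : ∀ b, Even (k j b) := fun b => (Int.even_add.1 (hpar j a b)).1 hja
    choose m hm using heven
    refine codeEquiv_of_map_intVec hC hD hg (m := m) ?_
    have : intVec m = g.symm (Pi.single j 2) := by
      rw [hk]; ext b
      simp only [Pi.smul_apply, intVec_apply, smul_eq_mul, hm b]
      push_cast; ring
    rw [this, g.apply_symm_apply]
    exact single_two_mem_shell D j

theorem half_frame_dot {C D : BinaryCode n} {g} (hg : IsLatIso C D g)
    {k : Fin n → Fin n → ℤ} (hk : ∀ j, g.symm (Pi.single j 2) = (1 / 2 : ℝ) • intVec (k j))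
    (i j : Fin n) : k i ⬝ᵥ k j = if i = j then 16 else 0 := by
  have h1 := hg.symm.dot (Pi.single i 2) (Pi.single j 2)
  rw [hk, hk, smul_dotProduct, dotProduct_smul, intVec_dotProduct, single_dotProduct,
    Pi.single_apply] at h1
  have h2 : ((k i ⬝ᵥ k j : ℤ) : ℝ) = ((if i = j then 16 else 0 : ℤ) : ℝ) := by
    simp only [smul_eq_mul] at h1
    split_ifs at h1 ⊢ <;> push_cast <;> linarith
  exact_mod_cast h2

theorem one_mem_of_half_odd {C D : BinaryCode n} {g} (hg : IsLatIso C D g) {k : Fin n → ℤ}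
    {j : Fin n} (hk : g.symm (Pi.single j 2) = (1 / 2 : ℝ) • intVec k) (hodd : ∀ a, Odd (k a)) :
    (1 : Fin n → ZMod 2) ∈ C := by
  have h1 : intVec k ∈ shell C 0 := by
    have h2 := (hg.symm.mem (Pi.single j 2 + Pi.single j 2)).2 (shell_congr
      (add_mem_shell (single_two_mem_shell D j) (single_two_mem_shell D j)) (by norm_num))
    rwa [map_add, hk, ← add_smul, add_halves, one_smul] at h2
  convert (intVec_mem_shell.1 h1).1
  ext a
  obtain ⟨l, hl⟩ := hodd a
  simp only [redMod, hl, Pi.one_apply]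
  push_cast
  rw [show (2 : ZMod 2) = 0 from rfl, zero_mul, zero_add]

theorem length_of_odd_norm {k : Fin n → ℤ} (hodd : ∀ a, Odd (k a)) (hk : k ⬝ᵥ k = 16)  :
    n = 8 ∨ n = 16 ∧ ∀ a, k a = 1 ∨ k a = -1 := by
  have h1 : ∀ a, ∃ l : ℤ, 0 ≤ l ∧ k a * k a = 8 * l + 1 := by
    intro a
    have h2 : k a * k a % 8 = 1 := by
      obtain ⟨b, hb⟩ := hodd a
      have : k a % 8 = 1 ∨ k a % 8 = 3 ∨ k a % 8 = 5 ∨ k a % 8 = 7 := by omega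
      rcases this with h | h | h | h <;> simp [Int.mul_emod, h]
    refine ⟨k a * k a / 8, ?_, by omega⟩
    have := mul_self_nonneg (k a)
    omega
  choose l hl hkl using h1
  have h3 : k ⬝ᵥ k = 8 * ∑ a, l a + n := by
    rw [dotProduct, Finset.sum_congr rfl fun a _ => hkl a, Finset.sum_add_distrib,
      ← Finset.mul_sum]
    simp
  have h4 : 0 ≤ ∑ a, l a := Finset.sum_nonneg fun a _ => hl a
  have h5 : n = 0 → ∑ a, l a = 0 := by rintro rfl; simp
  rw [hk] at h3
  have h6 : n = 8 ∨ n = 16 := by omega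
  refine h6.imp_right fun h => ⟨h, fun a => ?_⟩
  have h7 : ∑ a, l a = 0 := by omega
  have h8 := (Finset.sum_eq_zero_iff_of_nonneg fun a _ => hl a).1 h7 a (Finset.mem_univ a)
  have h9 := hkl a
  rw [h8] at h9
  exact mul_self_eq_one_iff.1 (by simpa using h9)

/-- If `C` is not self-dual, an isometry with half-integral frame forces equivalence. -/
theorem codeEquiv_of_not_isSelfDual {C D : BinaryCode n} (hC : IsDoublyEven C)
    (hD : IsDoublyEven D) (hsd : ¬ IsSelfDual C) {g} (hg : IsLatIso C D g)
    {k : Fin n → Fin n → ℤ} (hk : ∀ j, g.symm (Pi.single j 2) = (1 / 2 : ℝ) • intVec (k j))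
    (hodd : ∀ j a, Odd (k j a)) : CodeEquiv C D := by
  classical
  rcases Nat.eq_zero_or_pos n with rfl | hn
  · exact (hsd (Subsingleton.elim _ _)).elim
  let j₀ : Fin n := ⟨0, hn⟩
  have h1 := one_mem_of_half_odd hg (hk j₀) (hodd j₀)
  have hkk := half_frame_dot hg hk
  have hlen : ∀ j, n = 8 ∨ n = 16 ∧ ∀ a, k j a = 1 ∨ k j a = -1 := fun j =>
    length_of_odd_norm (hodd j) (by rw [hkk, if_pos rfl])
  obtain ⟨d, hd, hdC, hd4⟩ := exists_doublyEven_extension hC h1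
    (by rcases hlen j₀ with h | h <;> omega) hsd
  have hgk : g ((1 / 2 : ℝ) • intVec (k j₀)) = Pi.single j₀ 2 := by
    rw [← hk, g.apply_symm_apply]
  suffices h : ∃ P, IsTetradFamily P ∧ (∀ a, ∃ t ∈ P, a ∈ t) ∧
      ∀ t ∈ P, ind (ZMod 2) t + d ∈ C by
    obtain ⟨P, hP, hcov, hPC⟩ := h
    exact codeEquiv_of_half_odd hC hD hg (hodd j₀) hgk hP hcov hd hdC hPC
  by_cases h8 : n = 8
  · have hd0 : hammingNorm d ≠ 0 := fun h0 => hdC (by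
      rw [hammingNorm_eq_zero.1 h0]; exact C.zero_mem)
    have hd8 : hammingNorm (d + 1) ≠ 0 := fun h0 => hdC (by
      have h2 := C.add_mem (hammingNorm_eq_zero.1 h0 ▸ C.zero_mem : d + 1 ∈ C) h1
      rwa [add_assoc, word_add_self, add_zero] at h2)
    have hsum := hammingNorm_add_one d
    have hdd : hammingNorm d = 4 := by omega
    have hdd' : hammingNorm (d + 1) = 4 := by omega
    have hbit : ∀ a, (d + 1) a ≠ 0 ↔ d a = 0 := fun a => by
      simp only [Pi.add_apply, Pi.one_apply]
      generalize d a = b; revert b; decide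
    have hdisj : Disjoint (Finset.univ.filter fun a => d a ≠ 0)
        (Finset.univ.filter fun a => (d + 1) a ≠ 0) :=
      Finset.disjoint_left.2 fun a ha hb =>
        (Finset.mem_filter.1 ha).2 ((hbit a).1 (Finset.mem_filter.1 hb).2)
    refine ⟨{Finset.univ.filter fun a => d a ≠ 0, Finset.univ.filter fun a => (d + 1) a ≠ 0},
      ⟨?_, ?_⟩, ?_, ?_⟩
    · intro s hs t ht hst
      rcases Finset.mem_insert.1 hs with rfl | hs <;> rcases Finset.mem_insert.1 ht with rfl | ht
      · exact absurd rfl hst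
      · rw [Finset.mem_singleton.1 ht]; exact hdisj
      · rw [Finset.mem_singleton.1 hs]; exact hdisj.symm
      · exact absurd ((Finset.mem_singleton.1 hs).trans (Finset.mem_singleton.1 ht).symm) hst
    · intro t ht
      rcases Finset.mem_insert.1 ht with rfl | ht
      · exact hdd
      · rw [Finset.mem_singleton.1 ht]; exact hdd'
    · intro a
      by_cases ha : d a = 0
      · exact ⟨_, Finset.mem_insert_of_mem (Finset.mem_singleton_self _),
          Finset.mem_filter.2 ⟨Finset.mem_univ a, (hbit a).2 ha⟩⟩
      · exact ⟨_, Finset.mem_insert_self _ _, Finset.mem_filter.2 ⟨Finset.mem_univ a, ha⟩⟩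
    · intro t ht
      rcases Finset.mem_insert.1 ht with rfl | ht
      · rw [ind_support, word_add_self]; exact C.zero_mem
      · rw [Finset.mem_singleton.1 ht, ind_support, add_right_comm, word_add_self, zero_add]
        exact h1
  · have hlen' : ∀ j, n = 16 ∧ ∀ a, k j a = 1 ∨ k j a = -1 := fun j =>
      (hlen j).resolve_left h8
    have hn16 : n = 16 := (hlen' j₀).1
    set r : Fin n → Fin n → ZMod 2 := fun j a => if k j a = 1 then 0 else 1 with hr
    have hkr : ∀ j a, k j a = bitSign (r j a) := fun j a => by
      rcases (hlen' j).2 a with h | h <;> simp [hr, h, bitSign]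
    refine exists_tetrad_partition_of_hadamard hC hn16 h1 r (fun i j => ?_) (fun i j hij => ?_)
      hd hdC hd4
    · have h2 : g.symm (Pi.single i 2) - g.symm (Pi.single j 2) ∈ shell C 0 := by
        rw [← map_sub]
        exact (hg.symm.mem _).2
          (by simpa using sub_mem_shell (single_two_mem_shell D i) (single_two_mem_shell D j))
      obtain ⟨m, hm, hm1, -⟩ := h2
      convert hm1 using 1
      ext a
      have h3 := congrFun hm a
      rw [hk, hk] at h3
      simp only [Pi.sub_apply, Pi.smul_apply, smul_eq_mul, intVec_apply] at h3
      have h4 : k i a - k j a = 2 * m a := by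
        have : (k i a - k j a : ℝ) = 2 * m a := by linarith
        exact_mod_cast this
      simp only [Pi.add_apply, redMod]
      rw [hkr, hkr] at h4
      generalize r i a = x at *
      generalize r j a = y at *
      generalize m a = z at *
      have h5 : ∀ x : ZMod 2, x = 0 ∨ x = 1 := by decide
      rcases h5 x with rfl | rfl <;> rcases h5 y with rfl | rfl <;> simp [bitSign] at h4
      · subst h4; rfl
      · rw [show z = 1 by omega]; rfl
      · rw [show z = -1 by omega]; rfl
      · subst h4; rfl
    · have h2 : ∑ a, bitSign ((r i + r j) a) = k i ⬝ᵥ k j := by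
        rw [dotProduct]
        refine Finset.sum_congr rfl fun a _ => ?_
        rw [Pi.add_apply, bitSign_add, hkr, hkr]
      rw [sum_bitSign, hkk, if_neg hij] at h2
      omega

/-! ### First-order Reed–Muller codes in self-dual codes -/

theorem IsDoublyEven.one_mem_dualCode {C : BinaryCode n} (hC : IsDoublyEven C) :
    (1 : Fin n → ZMod 2) ∈ dualCode C := by
  intro y hy
  have h1 : (1 : Fin n → ZMod 2) ⬝ᵥ y = y ⬝ᵥ y := by
    refine Finset.sum_congr rfl fun i _ => ?_
    rw [Pi.one_apply]; generalize y i = a; revert a; decide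
  rw [h1, hC.dotProduct_eq_zero hy hy]

theorem dotProduct_comp_perm (σ : Equiv.Perm (Fin n)) (x y : Fin n → ZMod 2) :
    (x ∘ σ) ⬝ᵥ (y ∘ σ) = x ⬝ᵥ y :=
  Equiv.sum_comp σ fun i => x i * y i

theorem hammingNorm_comp_perm (σ : Equiv.Perm (Fin n)) (x : Fin n → ZMod 2) :
    hammingNorm (x ∘ σ) = hammingNorm x := by
  have h := sum_liftWord (x ∘ σ)
  rw [show ∑ i, liftWord (x ∘ σ) i = ∑ i, liftWord x i from
    Equiv.sum_comp σ fun i => liftWord x i, sum_liftWord] at h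
  exact_mod_cast h.symm

/-- In a doubly-even self-dual code there is a codeword separating the two elements of each pair
of a perfect matching of the coordinates. -/
theorem exists_codeword_separating {C : BinaryCode n} (hC : IsDoublyEven C) (hsd : IsSelfDual C)
    (τ : Equiv.Perm (Fin n)) (hτ : ∀ a, τ (τ a) = a) (hne : ∀ a, τ a ≠ a) :
    ∃ u ∈ C, ∀ a, u (τ a) = u a + 1 := by
  let Φ : (Fin n → ZMod 2) →ₗ[ZMod 2] (Fin n → ZMod 2) :=
    LinearMap.funLeft (ZMod 2) (ZMod 2) τ + LinearMap.id
  have hΦ : ∀ u, Φ u = u ∘ τ + u := fun u => rfl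
  have hττ : ∀ u : Fin n → ZMod 2, (u ∘ τ) ∘ τ = u := fun u => by ext a; simp [hτ]
  by_cases h1 : (1 : Fin n → ZMod 2) ∈ C.map Φ
  · obtain ⟨u, hu, hu1⟩ := Submodule.mem_map.1 h1
    refine ⟨u, hu, fun a => ?_⟩
    have := congrFun hu1 a
    rw [hΦ] at this
    simp only [Pi.add_apply, Function.comp_apply, Pi.one_apply] at this
    generalize u (τ a) = x at *
    generalize u a = y at *
    revert x y; decide
  · exfalso
    obtain ⟨κ, hκ, hκ1⟩ := exists_mem_dualCode_dotProduct_eq_one h1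
    have hy : κ + κ ∘ τ ∈ C := by
      rw [← hsd]
      intro u hu
      have h2 := hκ _ (Submodule.mem_map_of_mem hu)
      rw [hΦ, dotProduct_add, ← dotProduct_comp_perm τ κ (u ∘ τ), hττ] at h2
      rw [add_dotProduct, add_comm]
      exact h2
    have h3 := hammingNorm_add_eq κ (κ ∘ τ)
    rw [hammingNorm_comp_perm] at h3
    have h4 : (2 : ℤ) ∣ liftWord κ ⬝ᵥ liftWord (κ ∘ τ) := by
      rw [← dotProduct_eq_zero_iff_even]
      refine Finset.sum_involution (fun a _ => τ a) (fun a _ => ?_) (fun a _ _ => hne a)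
        (fun a _ => Finset.mem_univ _) (fun a _ => hτ a)
      simp only [Function.comp_apply, hτ]
      generalize κ (τ a) = x
      generalize κ a = y
      revert x y; decide
    have h5 := hC _ hy
    have h6 : 2 ∣ hammingNorm κ := by omega
    have h7 : κ ⬝ᵥ 1 = κ ⬝ᵥ κ := by
      refine Finset.sum_congr rfl fun i _ => ?_
      rw [Pi.one_apply]; generalize κ i = a; revert a; decide
    rw [h7, word_dotProduct_self, (ZMod.natCast_eq_zero_iff _ 2).2 h6] at hκ1
    exact zero_ne_one hκ1

/-- The coordinates of a doubly-even self-dual code of length `2 ^ k` can be identified with the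
points of `𝔽₂ᵏ` in such a way that the code contains the linear functions. -/
theorem exists_reedMuller_labelling {C : BinaryCode n} (hC : IsDoublyEven C) (hsd : IsSelfDual C)
    {k : ℕ} (hn : n = 2 ^ k) :
    ∃ e : Fin n ≃ (Fin k → ZMod 2), ∀ j, (fun a => e a j) ∈ C := by
  classical
  have hcard : Fintype.card (Fin n) = Fintype.card (Fin k → ZMod 2) := by
    simp [hn, ZMod.card]
  suffices h : ∀ J : Finset (Fin k), ∃ e : Fin n ≃ (Fin k → ZMod 2),
      ∀ j ∈ J, (fun a => e a j) ∈ C by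
    obtain ⟨e, he⟩ := h Finset.univ
    exact ⟨e, fun j => he j (Finset.mem_univ j)⟩
  intro J
  induction J using Finset.induction_on with
  | empty => exact ⟨Fintype.equivOfCardEq hcard, by simp⟩
  | insert j J hj ih =>
    obtain ⟨e, he⟩ := ih
    let flip : (Fin k → ZMod 2) → (Fin k → ZMod 2) := fun x => Function.update x j (x j + 1)
    have hflip : Function.Involutive flip := fun x => by
      simp only [flip, Function.update_self, Function.update_idem]
      rw [add_assoc, show (1 + 1 : ZMod 2) = 0 from rfl, add_zero, Function.update_eq_self]
    let τ : Equiv.Perm (Fin n) := (e.trans (hflip.toPerm flip)).trans e.symm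
    have hτe : ∀ a, e (τ a) = flip (e a) := fun a => by simp [τ]
    have hτ : ∀ a, τ (τ a) = a := fun a => e.injective (by rw [hτe, hτe, hflip])
    have hτne : ∀ a, τ a ≠ a := fun a h => by
      have h1 := congrFun (hτe a) j
      rw [h] at h1
      simp [flip] at h1
    obtain ⟨u, hu, hsep⟩ := exists_codeword_separating hC hsd τ hτ hτne
    let f : Fin n → (Fin k → ZMod 2) := fun a => Function.update (e a) j (u a)
    have hf : Function.Injective f := by
      intro a b hab
      have h1 : u a = u b := by
        have := congrFun hab j
        simpa [f] using this
      have h2 : ∀ i, i ≠ j → e a i = e b i := fun i hi => by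
        have := congrFun hab i
        simpa [f, hi] using this
      by_cases h3 : e a j = e b j
      · refine e.injective (funext fun i => ?_)
        by_cases hi : i = j
        · rw [hi]; exact h3
        · exact h2 i hi
      · exfalso
        have h4 : b = τ a := by
          refine e.injective (funext fun i => ?_)
          rw [hτe]
          by_cases hi : i = j
          · subst hi
            simp only [flip, Function.update_self]
            revert h3
            generalize e a i = x
            generalize e b i = y
            revert x y; decide
          · simp only [flip, Function.update_of_ne hi]
            exact (h2 i hi).symm
        rw [h4, hsep] at h1
        revert h1
        generalize u a = x
        revert x; decide
    let e' := Equiv.ofBijective f ((Fintype.bijective_iff_injective_and_card f).2 ⟨hf, hcard⟩)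
    have he' : ∀ a, e' a = f a := fun _ => rfl
    refine ⟨e', fun i hi => ?_⟩
    rcases Finset.mem_insert.1 hi with rfl | hi
    · convert hu using 1
      ext a; simp [he', f]
    · have hij : i ≠ j := fun h => hj (h ▸ hi)
      convert he i hi using 1
      ext a; simp [he', f, hij]

theorem linear_function_mem {C : BinaryCode n} {k : ℕ} {e : Fin n → (Fin k → ZMod 2)}
    (he : ∀ j, (fun a => e a j) ∈ C) (l : Fin k → ZMod 2) : (fun a => l ⬝ᵥ e a) ∈ C := by
  have : (fun a => l ⬝ᵥ e a) = ∑ j, l j • (fun a => e a j) := by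
    ext a; simp [dotProduct]
  rw [this]
  exact C.sum_mem fun j _ => C.smul_mem _ (he j)

theorem hammingNorm_linear_function {k : ℕ} (e : Fin n ≃ (Fin k → ZMod 2)) {l : Fin k → ZMod 2}
    (hl : l ≠ 0) : 2 * hammingNorm (fun a => l ⬝ᵥ e a) = n := by
  have h1 := sum_bitSign fun a => l ⬝ᵥ e a
  rw [Equiv.sum_comp e fun v => bitSign (l ⬝ᵥ v)] at h1
  have h2 := sum_bitSign_mul_pow (1 : ℤ) l
  obtain ⟨i, hi⟩ := Function.ne_iff.1 hl
  rw [Finset.prod_eq_zero (Finset.mem_univ i)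
    (by rw [Pi.zero_apply] at hi; simp [bitSign, hi])] at h2
  simp only [one_pow, mul_one, Int.cast_id] at h2
  simp only [dotProduct_comm l] at h1
  rw [h2] at h1
  simp only [dotProduct_comm l]
  omega

theorem mem_iff_affine_of_length_eight {C : BinaryCode n} (hn : n = 8) (hC : IsDoublyEven C)
    (hsd : IsSelfDual C) {e : Fin n ≃ (Fin 3 → ZMod 2)} (he : ∀ j, (fun a => e a j) ∈ C)
    (c : Fin n → ZMod 2) :
    c ∈ C ↔ ∃ p : ZMod 2 × (Fin 3 → ZMod 2), c = fun a => p.1 + p.2 ⬝ᵥ e a := by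
  classical
  let F : ZMod 2 × (Fin 3 → ZMod 2) → (Fin n → ZMod 2) := fun p a => p.1 + p.2 ⬝ᵥ e a
  have h1 : (1 : Fin n → ZMod 2) ∈ C := hsd ▸ hC.one_mem_dualCode
  have hFC : ∀ p, F p ∈ C := by
    intro p
    have : F p = p.1 • (1 : Fin n → ZMod 2) + fun a => p.2 ⬝ᵥ e a := by
      ext a; simp [F]
    rw [this]
    exact C.add_mem (C.smul_mem _ h1) (linear_function_mem he _)
  have hF : Function.Injective F := by
    intro p q hpq
    have h2 : ∀ v, p.1 + p.2 ⬝ᵥ v = q.1 + q.2 ⬝ᵥ v := fun v => by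
      have := congrFun hpq (e.symm v)
      simpa [F] using this
    have h3 : p.1 = q.1 := by simpa using h2 0
    refine Prod.ext h3 (funext fun j => ?_)
    have := h2 (Pi.single j 1)
    rw [h3] at this
    simpa using this
  have hcard : (Finset.univ.filter (· ∈ C)).card = 16 := by
    have h2 := card_mul_card_dualCode C
    have h3 : dualCode C = C := hsd
    simp only [h3] at h2
    have h4 : 2 ^ n = 256 := by rw [hn]; norm_num
    rw [Fintype.card_subtype, h4] at h2
    nlinarith
  have hsub : Finset.univ.image F ⊆ Finset.univ.filter (· ∈ C) := by
    intro x hx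
    obtain ⟨p, -, rfl⟩ := Finset.mem_image.1 hx
    exact Finset.mem_filter.2 ⟨Finset.mem_univ _, hFC p⟩
  have heq := Finset.eq_of_subset_of_card_le hsub (by
    rw [hcard, Finset.card_image_of_injective _ hF]
    simp [ZMod.card])
  constructor
  · intro hc
    have : c ∈ Finset.univ.image F := heq ▸ Finset.mem_filter.2 ⟨Finset.mem_univ c, hc⟩
    obtain ⟨p, -, hp⟩ := Finset.mem_image.1 this
    exact ⟨p, hp.symm⟩
  · rintro ⟨p, rfl⟩
    exact hFC p

/-- Doubly-even self-dual codes of length `8` are equivalent. -/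
theorem codeEquiv_of_length_eight {C D : BinaryCode n} (hn : n = 8) (hC : IsDoublyEven C)
    (hD : IsDoublyEven D) (hCs : IsSelfDual C) (hDs : IsSelfDual D) : CodeEquiv C D := by
  obtain ⟨e, he⟩ := exists_reedMuller_labelling hC hCs (k := 3) (by rw [hn]; norm_num)
  obtain ⟨f, hf⟩ := exists_reedMuller_labelling hD hDs (k := 3) (by rw [hn]; norm_num)
  refine ⟨f.trans e.symm, ?_⟩
  ext c
  simp only [Set.mem_image, SetLike.mem_coe, mem_iff_affine_of_length_eight hn hC hCs he,
    mem_iff_affine_of_length_eight hn hD hDs hf]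
  constructor
  · rintro ⟨_, ⟨p, rfl⟩, rfl⟩
    exact ⟨p, by ext a; simp⟩
  · rintro ⟨p, rfl⟩
    exact ⟨_, ⟨p, rfl⟩, by ext a; simp⟩

/-! ### Self-dual codes of length `16` -/

theorem mem_sup_span_singleton_iff {E : BinaryCode n} {d x : Fin n → ZMod 2} :
    x ∈ E ⊔ Submodule.span (ZMod 2) {d} ↔ x ∈ E ∨ x + d ∈ E := by
  constructor
  · intro hx
    obtain ⟨y, hy, z, hz, rfl⟩ := Submodule.mem_sup.1 hx
    obtain ⟨a, rfl⟩ := Submodule.mem_span_singleton.1 hz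
    have : ∀ a : ZMod 2, a = 0 ∨ a = 1 := by decide
    rcases this a with rfl | rfl
    · left; simpa using hy
    · right; rw [one_smul, add_assoc, word_add_self, add_zero]; exact hy
  · rintro (hx | hx)
    · exact Submodule.mem_sup_left hx
    · have := Submodule.add_mem _ (Submodule.mem_sup_left (T := Submodule.span (ZMod 2) {d}) hx)
        (Submodule.mem_sup_right (Submodule.mem_span_singleton_self d))
      rwa [add_assoc, word_add_self, add_zero] at this

theorem mem_dualCode_span_singleton {d x : Fin n → ZMod 2} :
    x ∈ dualCode (Submodule.span (ZMod 2) {d}) ↔ x ⬝ᵥ d = 0 := by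
  constructor
  · exact fun h => h d (Submodule.mem_span_singleton_self d)
  · intro h y hy
    obtain ⟨a, rfl⟩ := Submodule.mem_span_singleton.1 hy
    rw [dotProduct_smul, h, smul_zero]

theorem mem_dualCode_sup {E F : BinaryCode n} {x : Fin n → ZMod 2} :
    x ∈ dualCode (E ⊔ F) ↔ x ∈ dualCode E ∧ x ∈ dualCode F := by
  constructor
  · exact fun h => ⟨fun y hy => h y (Submodule.mem_sup_left hy),
      fun y hy => h y (Submodule.mem_sup_right hy)⟩
  · rintro ⟨h1, h2⟩ y hy
    obtain ⟨a, ha, b, hb, rfl⟩ := Submodule.mem_sup.1 hy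
    rw [dotProduct_add, h1 a ha, h2 b hb, add_zero]

theorem intVec_liftWord_sub_mem_shell {E : BinaryCode n} {d : Fin n → ZMod 2} {m : Fin n → ℤ}
    (hd4 : 4 ∣ hammingNorm d) (hm : redMod m + d ∈ E) (hs : (4 : ℤ) ∣ ∑ i, m i) :
    intVec m - intVec (liftWord d) ∈ shell E 0 := by
  rw [← intVec_sub, intVec_mem_shell, redMod_sub, redMod_liftWord, word_sub_eq_add]
  simp only [Pi.sub_apply, Finset.sum_sub_distrib, sum_liftWord]
  exact ⟨hm, by omega⟩

theorem mem_shell_sup_span_singleton {E F : BinaryCode n} {d : Fin n → ZMod 2}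
    (hF : ∀ x, x ∈ F ↔ x ∈ E ∨ x + d ∈ E) (hd4 : 4 ∣ hammingNorm d) (x : Fin n → ℝ) :
    x ∈ shell F 0 ↔ x ∈ shell E 0 ∨ x - intVec (liftWord d) ∈ shell E 0 := by
  constructor
  · rintro ⟨m, rfl, h1, h2⟩
    rcases (hF _).1 h1 with h | h
    · exact Or.inl (intVec_mem_shell.2 ⟨h, h2⟩)
    · exact Or.inr (intVec_liftWord_sub_mem_shell hd4 h (by simpa using h2))
  · rintro (⟨m, rfl, h1, h2⟩ | ⟨m, hm, h1, h2⟩)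
    · exact intVec_mem_shell.2 ⟨(hF _).2 (Or.inl h1), h2⟩
    · refine ⟨m + liftWord d, ?_, ?_, ?_⟩
      · rw [intVec_add, ← hm, sub_add_cancel]
      · rw [redMod_add, redMod_liftWord, hF, add_assoc, word_add_self, add_zero]
        exact Or.inr h1
      · simp only [Pi.add_apply, Finset.sum_add_distrib, sum_liftWord]
        omega

/-- The frame class can be moved to the class of a doubly-even word of the dual code. -/
theorem exists_isLatIso_shell_two_to_word {E : BinaryCode n} (hE : IsDoublyEven E) (hn : n = 16)
    (h1 : (1 : Fin n → ZMod 2) ∈ E) (r : Fin n → Fin n → ZMod 2)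
    (hr : ∀ i j, r i + r j ∈ E) (hw : ∀ i j, i ≠ j → 2 * hammingNorm (r i + r j) = n)
    {d : Fin n → ZMod 2} (hd : d ∈ dualCode E) (hdE : d ∉ E) (hd4 : 4 ∣ hammingNorm d) :
    ∃ g, IsLatIso E E g ∧ ∃ x, x ∈ shell E 2 ∧ g x - intVec (liftWord d) ∈ shell E 0 := by
  obtain ⟨P, hP, hcov, hPE⟩ := exists_tetrad_partition_of_hadamard hE hn h1 r hr hw hd hdE hd4
  obtain ⟨z, hz, hzd⟩ := exists_mem_dualCode_dotProduct_eq_one hdE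
  have h0 := isLatIso_tetradRefl hP hcov
    (fun t ht => mem_dualCode_of_add_mem hE (hPE t ht) hd)
    (fun s hs t ht => add_mem_of_add_mem (hPE s hs) (hPE t ht))
  let a : Fin n := ⟨0, by omega⟩
  obtain ⟨t, ht, ha⟩ := hcov a
  refine ⟨_, h0.trans (isLatIso_signFlip hz), Pi.single a 2, single_two_mem_shell E a, ?_⟩
  rw [LinearEquiv.trans_apply, tetradRefl_single hP ht ha]
  have h2 : (Pi.single a 2 - ind ℝ t : Fin n → ℝ) = intVec (Pi.single a 2 - ind ℤ t) := by
    rw [intVec_sub, intVec_single, intVec_ind]; norm_num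
  have hred : redMod (Pi.single a 2 - ind ℤ t) = ind (ZMod 2) t := by
    rw [redMod_sub, redMod_single_even (dvd_refl _), redMod_ind, word_sub_eq_add, zero_add]
  rw [h2, signFlip_intVec]
  refine intVec_liftWord_sub_mem_shell hd4 (by rw [redMod_intFlip, hred]; exact hPE t ht) ?_
  rw [sum_intFlip]
  have h3 : ((liftWord z ⬝ᵥ (Pi.single a 2 - ind ℤ t) : ℤ) : ZMod 2) = 1 := by
    rw [← redMod_dotProduct, redMod_liftWord, hred]
    have := hz _ (hPE t ht)
    rw [dotProduct_add, hzd] at this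
    revert this; generalize z ⬝ᵥ ind (ZMod 2) t = b; revert b; decide
  have h4 : ¬ (2 : ℤ) ∣ liftWord z ⬝ᵥ (Pi.single a 2 - ind ℤ t) := fun h => by
    rw [(ZMod.intCast_zmod_eq_zero_iff_dvd _ 2).2 (by exact_mod_cast h)] at h3
    exact zero_ne_one h3
  have h5 : ∑ i, (Pi.single a 2 - ind ℤ t : Fin n → ℤ) i = -2 := by
    simp only [Pi.sub_apply, Finset.sum_sub_distrib, sum_ind, hP.card t ht]
    simp
  rw [h5]
  omega

/-- Two doubly-even codes `E + d₀` and `E + d` have isometric lattices when `E` contains the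
differences of the rows of a Hadamard matrix of order `16`. -/
theorem exists_isLatIso_of_extensions {E C D : BinaryCode n} (hE : IsDoublyEven E) (hn : n = 16)
    (h1 : (1 : Fin n → ZMod 2) ∈ E) (r : Fin n → Fin n → ZMod 2)
    (hr : ∀ i j, r i + r j ∈ E) (hw : ∀ i j, i ≠ j → 2 * hammingNorm (r i + r j) = n)
    {d₀ d : Fin n → ZMod 2} (hd₀ : d₀ ∈ dualCode E) (hdE₀ : d₀ ∉ E) (hd4₀ : 4 ∣ hammingNorm d₀)
    (hd : d ∈ dualCode E) (hdE : d ∉ E) (hd4 : 4 ∣ hammingNorm d)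
    (hC : ∀ x, x ∈ C ↔ x ∈ E ∨ x + d₀ ∈ E) (hD : ∀ x, x ∈ D ↔ x ∈ E ∨ x + d ∈ E) :
    ∃ g, IsLatIso C D g := by
  obtain ⟨g₀, hg₀, x₀, hx₀, hgx₀⟩ :=
    exists_isLatIso_shell_two_to_word hE hn h1 r hr hw hd₀ hdE₀ hd4₀
  obtain ⟨g, hg, x, hx, hgx⟩ := exists_isLatIso_shell_two_to_word hE hn h1 r hr hw hd hdE hd4
  have hh := hg₀.symm.trans hg
  set h := g₀.symm.trans g
  have key : h (intVec (liftWord d₀)) - intVec (liftWord d) ∈ shell E 0 := by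
    have h2 := (hh.mem _).2 hgx₀
    have h3 : h (g₀ x₀) = g x₀ := by simp [h]
    rw [map_sub, h3] at h2
    have h4 : g (x₀ - x) ∈ shell E 0 := (hg.mem _).2 (by simpa using sub_mem_shell hx₀ hx)
    have h5 := add_mem_shell (sub_mem_shell h4 h2) hgx
    simp only [sub_zero, add_zero, map_sub] at h5
    convert h5 using 1
    abel
  refine ⟨h, hh.dot, fun y => ?_⟩
  rw [mem_shell_sup_span_singleton hC hd4₀, mem_shell_sup_span_singleton hD hd4, hh.mem,
    ← hh.mem (y - intVec (liftWord d₀)), map_sub]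
  refine or_congr_right ⟨fun h2 => ?_, fun h2 => ?_⟩
  · have := sub_mem_shell h2 key
    rw [sub_zero] at this
    convert this using 1
    abel
  · have := add_mem_shell h2 key
    rw [add_zero] at this
    convert this using 1
    abel

theorem exists_isLatIso_of_common_hadamard (hn : n = 16) (r : Fin n → Fin n → ZMod 2)
    (hw : ∀ i j, i ≠ j → 2 * hammingNorm (r i + r j) = n) {D : BinaryCode n}
    (hD : IsDoublyEven D) (hDs : IsSelfDual D) (hrD : ∀ i j, r i + r j ∈ D) (N : ℕ) :
    ∀ C : BinaryCode n, IsDoublyEven C → IsSelfDual C → (∀ i j, r i + r j ∈ C) →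
      ((D : Set (Fin n → ZMod 2)) \ C).ncard = N → ∃ g, IsLatIso C D g := by
  induction N using Nat.strong_induction_on with
  | _ N ih =>
    intro C hC hCs hrC hN
    by_cases hDC : D ≤ C
    · have : C = D := by
        refine le_antisymm (fun x hx => ?_) hDC
        rw [← hDs]
        exact fun y hy => hC.dotProduct_eq_zero hx (hDC hy)
      subst this
      exact ⟨LinearEquiv.refl ℝ _, fun _ _ => rfl, fun _ => Iff.rfl⟩
    · obtain ⟨d, hdD, hdC⟩ := SetLike.not_le_iff_exists.1 hDC
      have hd4 := hD d hdD
      have hdd : d ⬝ᵥ d = 0 := hD.dotProduct_eq_zero hdD hdD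
      set E : BinaryCode n := C ⊓ dualCode (Submodule.span (ZMod 2) {d}) with hEdef
      have hmemE : ∀ x, x ∈ E ↔ x ∈ C ∧ x ⬝ᵥ d = 0 := fun x => by
        rw [hEdef, Submodule.mem_inf, mem_dualCode_span_singleton]
      set C₁ : BinaryCode n := E ⊔ Submodule.span (ZMod 2) {d} with hC₁def
      have hmemC₁ : ∀ x, x ∈ C₁ ↔ x ∈ E ∨ x + d ∈ E := fun x => mem_sup_span_singleton_iff
      have hE : IsDoublyEven E := fun x hx => hC x ((hmemE x).1 hx).1
      have hdE : d ∉ E := fun h => hdC ((hmemE d).1 h).1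
      have hdE' : d ∈ dualCode E := fun x hx => by
        rw [dotProduct_comm]; exact ((hmemE x).1 hx).2
      have hDmem : ∀ x ∈ D, x ∈ C → x ∈ E := fun x hxD hxC =>
        (hmemE x).2 ⟨hxC, hD.dotProduct_eq_zero hxD hdD⟩
      have h1 : (1 : Fin n → ZMod 2) ∈ E :=
        hDmem 1 (hDs ▸ hD.one_mem_dualCode) (hCs ▸ hC.one_mem_dualCode)
      have hrE : ∀ i j, r i + r j ∈ E := fun i j => hDmem _ (hrD i j) (hrC i j)
      have hC₁ : IsDoublyEven C₁ := fun x hx => by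
        rcases (hmemC₁ x).1 hx with h | h
        · exact hE x h
        · have h2 := (four_dvd_hammingNorm_add_iff (hE _ h) hd4).2 ((hmemE _).1 h).2
          rwa [add_assoc, word_add_self, add_zero] at h2
      have hdualE : dualCode E = C ⊔ Submodule.span (ZMod 2) {d} := by
        rw [← dualCode_dualCode (C ⊔ Submodule.span (ZMod 2) {d})]
        congr 1
        ext x
        rw [mem_dualCode_sup, hEdef, Submodule.mem_inf]
        rw [show dualCode C = C from hCs]
      have hC₁s : IsSelfDual C₁ := by
        refine le_antisymm (fun x hx => ?_) hC₁.le_dualCode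
        obtain ⟨hxE, hxd⟩ := mem_dualCode_sup.1 hx
        rw [mem_dualCode_span_singleton] at hxd
        rw [hdualE, mem_sup_span_singleton_iff] at hxE
        rw [hmemC₁, hmemE, hmemE]
        refine hxE.imp (fun h => ⟨h, hxd⟩) fun h => ⟨h, ?_⟩
        rw [add_dotProduct, hxd, hdd, add_zero]
      have hd₀ : ∃ d₀ ∈ C, d₀ ⬝ᵥ d ≠ 0 := by
        by_contra! h
        refine hdC ?_
        rw [← hCs]
        exact fun y hy => by rw [dotProduct_comm]; exact h y hy
      obtain ⟨d₀, hd₀C, hd₀d⟩ := hd₀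
      have hmemC : ∀ x, x ∈ C ↔ x ∈ E ∨ x + d₀ ∈ E := by
        intro x
        rw [hmemE, hmemE, add_dotProduct]
        constructor
        · intro hx
          by_cases hxd : x ⬝ᵥ d = 0
          · exact Or.inl ⟨hx, hxd⟩
          · refine Or.inr ⟨C.add_mem hx hd₀C, ?_⟩
            revert hxd hd₀d
            generalize x ⬝ᵥ d = a
            generalize d₀ ⬝ᵥ d = b
            revert a b; decide
        · rintro (h | h)
          · exact h.1
          · have := C.add_mem h.1 hd₀C
            rwa [add_assoc, word_add_self, add_zero] at this
      obtain ⟨g, hg⟩ := exists_isLatIso_of_extensions hE hn h1 r hrE hw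
        (fun y hy => hC.dotProduct_eq_zero hd₀C ((hmemE y).1 hy).1)
        (fun h => hd₀d ((hmemE _).1 h).2) (hC _ hd₀C) hdE' hdE hd4 hmemC hmemC₁
      have hlt : ((D : Set (Fin n → ZMod 2)) \ C₁).ncard < N := by
        rw [← hN]
        refine Set.ncard_lt_ncard ⟨fun x hx => ⟨hx.1, fun hxC => hx.2 ?_⟩, fun h => ?_⟩
          (Set.toFinite _)
        · exact (hmemC₁ x).2 (Or.inl (hDmem x hx.1 hxC))
        · refine (h ⟨hdD, hdC⟩).2 ((hmemC₁ d).2 (Or.inr ?_))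
          rw [word_add_self]; exact E.zero_mem
      obtain ⟨g', hg'⟩ := ih _ hlt C₁ hC₁ hC₁s
        (fun i j => (hmemC₁ _).2 (Or.inl (hrE i j))) rfl
      exact ⟨_, hg.trans hg'⟩

/-- The lattices of doubly-even self-dual codes of length `16` are isometric. -/
theorem exists_isLatIso_of_length_sixteen {C D : BinaryCode n} (hn : n = 16)
    (hC : IsDoublyEven C) (hD : IsDoublyEven D) (hCs : IsSelfDual C) (hDs : IsSelfDual D) :
    ∃ g, IsLatIso C D g := by
  obtain ⟨e, he⟩ := exists_reedMuller_labelling hC hCs (k := 4) (by rw [hn]; norm_num)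
  obtain ⟨f, hf⟩ := exists_reedMuller_labelling hD hDs (k := 4) (by rw [hn]; norm_num)
  let σ : Equiv.Perm (Fin n) := f.trans e.symm
  let C' : BinaryCode n := C.comap (LinearMap.funLeft (ZMod 2) (ZMod 2) σ.symm)
  have hmem : ∀ x, x ∈ C' ↔ x ∘ σ.symm ∈ C := fun x => Iff.rfl
  have hinv : ∀ x : Fin n → ZMod 2, (x ∘ σ) ∘ σ.symm = x := fun x => by ext i; simp
  have hinv' : ∀ x : Fin n → ZMod 2, (x ∘ σ.symm) ∘ σ = x := fun x => by ext i; simp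
  have hequiv : CodeEquiv C C' := by
    refine ⟨σ, ?_⟩
    ext x
    constructor
    · rintro ⟨y, hy, rfl⟩
      rw [SetLike.mem_coe, hmem]
      change (y ∘ σ) ∘ σ.symm ∈ C
      rw [hinv]; exact hy
    · intro hx
      exact ⟨x ∘ σ.symm, hx, hinv' x⟩
  have hC' : IsDoublyEven C' := fun x hx => by
    rw [← hammingNorm_comp_perm σ.symm]; exact hC _ hx
  have hCs' : IsSelfDual C' := by
    refine le_antisymm (fun x hx => ?_) hC'.le_dualCode
    rw [hmem, ← hCs]
    intro y hy
    have h1 : y ∘ σ ∈ C' := by rw [hmem, hinv]; exact hy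
    rw [← hx _ h1, ← dotProduct_comp_perm σ.symm x, hinv]
  have hf' : ∀ j, (fun a => f a j) ∈ C' := fun j => by
    rw [hmem]
    convert he j using 1
    ext a; simp [σ]
  set r : Fin n → Fin n → ZMod 2 := fun i a => f i ⬝ᵥ f a with hr
  have hrr : ∀ i j, r i + r j = fun a => (f i + f j) ⬝ᵥ f a := fun i j => by
    ext a; simp [hr, add_dotProduct]
  obtain ⟨g, hg⟩ := hequiv.exists_isLatIso
  obtain ⟨g', hg'⟩ := exists_isLatIso_of_common_hadamard hn r (fun i j hij => by
      rw [hrr]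
      refine hammingNorm_linear_function f fun h0 => hij (f.injective ?_)
      funext l
      have := congrFun h0 l
      simp only [Pi.add_apply, Pi.zero_apply] at this
      revert this
      generalize f i l = x
      generalize f j l = y
      revert x y; decide)
    hD hDs (fun i j => by rw [hrr]; exact linear_function_mem hf _) _ C' hC' hCs'
    (fun i j => by rw [hrr]; exact linear_function_mem hf' _) rfl
  exact ⟨_, hg.trans hg'⟩

theorem CodeEquiv.symm {C D : BinaryCode n} (h : CodeEquiv C D) : CodeEquiv D C := by
  obtain ⟨σ, hσ⟩ := h
  refine ⟨σ.symm, ?_⟩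
  rw [← hσ, Set.image_image]
  convert Set.image_id _ using 2
  ext x i
  simp

end CodeLattice

theorem theorem1p3 (n : ℕ) (C D : CodeLattice.BinaryCode n)
    (hC : CodeLattice.IsDoublyEven C) (hD : CodeLattice.IsDoublyEven D) :
    CodeLattice.LatticeIso (CodeLattice.latticePlus C) (CodeLattice.latticePlus D) ↔
      CodeLattice.CodeEquiv C D ∨
        (n = 16 ∧ CodeLattice.IsSelfDual C ∧ CodeLattice.IsSelfDual D) := by
  rw [CodeLattice.latticeIso_iff hC hD]
  constructor
  · rintro ⟨g, hg⟩
    rcases CodeLattice.frame_cases hC hD hg with h | ⟨k, hk, hodd⟩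
    · exact Or.inl h
    by_cases hCs : CodeLattice.IsSelfDual C
    · by_cases hDs : CodeLattice.IsSelfDual D
      · rcases Nat.eq_zero_or_pos n with rfl | hn
        · left
          rw [Subsingleton.elim D C]
          exact ⟨1, by simp⟩
        · have hkk := CodeLattice.half_frame_dot hg hk ⟨0, hn⟩ ⟨0, hn⟩
          rw [if_pos rfl] at hkk
          rcases CodeLattice.length_of_odd_norm (hodd ⟨0, hn⟩) hkk with h | ⟨h, -⟩
          · exact Or.inl (CodeLattice.codeEquiv_of_length_eight h hC hD hCs hDs)
          · exact Or.inr ⟨h, hCs, hDs⟩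
      · left
        refine CodeLattice.CodeEquiv.symm ?_
        rcases CodeLattice.frame_cases hD hC hg.symm with h | ⟨l, hl, hlodd⟩
        · exact h
        · exact CodeLattice.codeEquiv_of_not_isSelfDual hD hC hDs hg.symm hl hlodd
    · exact Or.inl (CodeLattice.codeEquiv_of_not_isSelfDual hC hD hCs hg hk hodd)
  · rintro (h | ⟨hn, hCs, hDs⟩)
    · exact h.exists_isLatIso
    · exact CodeLattice.exists_isLatIso_of_length_sixteen hn hC hD hCs hDs
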